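/- Let $\mathcal X,\mathcal Y$ be finite sets, let $Q_X$ be a probability vector on $\mathcal X$ with $Q_X(x)>0$ for all $x$, and let $Q_{Y|X=x}$, $x\in\mathcal X$, be pairwise distinct probability vectors on $\mathcal Y$. Let $X\sim Q_X$ and, given $X=x$, let $Y^n=(Y_1,\dots,Y_n)$ be i.i.d. with law $Q_{Y|X=x}$. Write $E_x$ for the probability vector on $\mathcal X$ with a $1$ in position $x$. Let $f(P,Q)$ be a real-valued function of a probability vector $P$ on $\mathcal X$ and a full-support probability vector $Q$ on $\mathcal X$, continuous in $(P,Q)$, such that for each $Q$ the function $f(\cdot,Q)$ extends to a function on $\mathbb R^{\mathcal X}$ that is infinitely differentiable in a neighbourhood of each $E_x$, and such that for every full-support $Q=(q_x)_{x\in\mathcal X}$: (1) $f(Q,Q)=0$; (2) $f(E_x,Q)>0$ for all $x$; (3) $f(\sum_i\lambda_iP_i,Q)\le\max_i f(P_i,Q)$ for all finite convex combinations of probability vectors $P_i$; (4) $q_x\ge q_{x'}$ implies $f(E_x,Q)\le f(E_{x'},Q)$; (5) each $E_x$ is a strict local maximum of $f(\cdot,Q)$ on the probability simplex. Let $L_n=f(Q_{X|Y^n},Q_X)$,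 where $Q_{X|Y^n}$ is the posterior law of $X$ given $Y^n$, let $I_X=f(E_X,Q_X)$, and let $F_{L_n},F_{I_X}$ be their cumulative distribution functions. With base-2 logarithms, $\log 0=-\infty$, and $$C(P_1\|P_2)=-\inf_{0\le\lambda\le1}\log\sum_yP_1(y)^\lambda P_2(y)^{1-\lambda}\in[0,\infty],$$ one has $$\limsup_{n\to\infty}\frac1n\log\|F_{L_n}-F_{I_X}\|_{1}\le-\min_{x\ne x'}C(Q_{Y|X=x}\|Q_{Y|X=x'}),$$ where $\|\cdot\|_1$ is the $L^1(\mathbb R)$ norm. If moreover $(U-E_x)\cdot\nabla_Pf(P,Q_X)|_{P=E_x}<0$ for every $x$ and every probability vector $U\ne E_x$ (the derivative property), then the limit exists and equals the right-hand side. -/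

import Mathlib

open Set Filter Topology MeasureTheory
open scoped ENNReal ContDiff

/-- Base-2 logarithm of an extended nonnegative real, with `log 0 = -∞` and `log ∞ = ∞`. -/
noncomputable def log2 (a : ℝ≥0∞) : EReal :=
  ENNReal.log a / ((Real.log 2 : ℝ) : EReal)

/-- The extreme point `E_x` of the probability simplex over `X`. -/
def extremePt {X : Type*} [DecidableEq X] (x : X) : X → ℝ := Pi.single x 1

/-- The probability vectors over `X` all of whose entries are positive. -/
def fullSupport (X : Type*) [Fintype X] : Set (X → ℝ) :=
  {Q | Q ∈ stdSimplex ℝ X ∧ ∀ x, 0 < Q x}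

/-- Pointwise leakage functions `f (P, Q)`; `P` is the posterior and `Q` the prior.
The function is given together with an extension beyond the simplex; off the simplex only its
smoothness near the extreme points is constrained. -/
structure IsPointwiseLeakage {X : Type*} [Fintype X] [DecidableEq X]
    (f : (X → ℝ) → (X → ℝ) → ℝ) : Prop where
  /-- `f` is continuous in the pair `(P, Q)`. -/
  continuousOn : ContinuousOn (fun z : (X → ℝ) × (X → ℝ) => f z.1 z.2)
    (stdSimplex ℝ X ×ˢ fullSupport X)
  /-- For fixed `Q`, `f` is infinitely differentiable around every extreme point. -/
  smooth : ∀ Q ∈ fullSupport X, ∀ x, ∃ U ∈ 𝓝 (extremePt x),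
    ContDiffOn ℝ ∞ (fun P => f P Q) U
  /-- No change of belief, no leakage. -/
  self_eq_zero : ∀ Q ∈ fullSupport X, f Q Q = 0
  /-- Learning the realisation leaks something. -/
  extreme_pos : ∀ Q ∈ fullSupport X, ∀ x, 0 < f (extremePt x) Q
  /-- A mixture of posteriors leaks at most as much as the worst of them. -/
  mixture_le : ∀ Q ∈ fullSupport X, ∀ (k : ℕ) (P : Fin k → X → ℝ) (c : Fin k → ℝ),
    (∀ i, P i ∈ stdSimplex ℝ X) → (∀ i, 0 ≤ c i) → ∑ i, c i = 1 →
      f (∑ i, c i • P i) Q ≤ ⨆ i, f (P i) Q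
  /-- A less likely realisation carries at least as much information. -/
  extreme_anti : ∀ Q ∈ fullSupport X, ∀ i j, Q j ≤ Q i →
    f (extremePt i) Q ≤ f (extremePt j) Q
  /-- Every extreme point is a strict local maximum over the simplex. -/
  strict_local_max : ∀ Q ∈ fullSupport X, ∀ x,
    ∀ᶠ P in 𝓝[stdSimplex ℝ X \ {extremePt x}] (extremePt x), f P Q < f (extremePt x) Q

/-- The derivative property at the prior `Q`: at each extreme point, the directional derivative
of `f (·, Q)` towards any other probability vector is negative. -/
def HasDerivativeProperty {X : Type*} [Fintype X] [DecidableEq X]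
    (f : (X → ℝ) → (X → ℝ) → ℝ) (Q : X → ℝ) : Prop :=
  ∀ x, ∀ U ∈ stdSimplex ℝ X, U ≠ extremePt x →
    fderiv ℝ (fun P => f P Q) (extremePt x) (U - extremePt x) < 0

/-- `Pr{X = x, Y^n = y^n}` for the prior `QX` and `n` observations which, given `X = x`, are
i.i.d. with law `W x`. -/
def jointProb {X Y : Type*} (QX : X → ℝ) (W : X → Y → ℝ) (n : ℕ) (x : X) (y : Fin n → Y) : ℝ :=
  QX x * ∏ i, W x (y i)

/-- `Pr{Y^n = y^n}`. -/
def outputProb {X Y : Type*} [Fintype X] (QX : X → ℝ) (W : X → Y → ℝ) (n : ℕ)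
    (y : Fin n → Y) : ℝ :=
  ∑ x, jointProb QX W n x y

/-- The posterior `Q_{X | Y^n = y^n}` (only relevant when `Pr{Y^n = y^n} > 0`). -/
noncomputable def posterior {X Y : Type*} [Fintype X] (QX : X → ℝ) (W : X → Y → ℝ) (n : ℕ)
    (y : Fin n → Y) : X → ℝ :=
  fun x => jointProb QX W n x y / outputProb QX W n y

/-- The CDF of `L_n = f (Q_{X | Y^n}, Q_X)`. -/
noncomputable def leakageCDF {X Y : Type*} [Fintype X] [Fintype Y]
    (f : (X → ℝ) → (X → ℝ) → ℝ) (QX : X → ℝ) (W : X → Y → ℝ) (n : ℕ) (l : ℝ) : ℝ :=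
  ∑ y : Fin n → Y, if f (posterior QX W n y) QX ≤ l then outputProb QX W n y else 0

/-- The CDF of `I_X = f (E_X, Q_X)`. -/
noncomputable def informationCDF {X : Type*} [Fintype X] [DecidableEq X]
    (f : (X → ℝ) → (X → ℝ) → ℝ) (QX : X → ℝ) (l : ℝ) : ℝ :=
  ∑ x, if f (extremePt x) QX ≤ l then QX x else 0

/-- `(1/n) log ‖F_{L_n} - F_{I_X}‖₁`. -/
noncomputable def normalizedLogDist {X Y : Type*} [Fintype X] [DecidableEq X] [Fintype Y]
    (f : (X → ℝ) → (X → ℝ) → ℝ) (QX : X → ℝ) (W : X → Y → ℝ) (n : ℕ) : EReal :=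
  ((1 / (n : ℝ) : ℝ) : EReal) *
    log2 (eLpNorm (leakageCDF f QX W n - informationCDF f QX) 1 volume)

/-- Chernoff information; it is `∞` for distributions with disjoint supports. -/
noncomputable def chernoffInfo {Y : Type*} [Fintype Y] (P₁ P₂ : Y → ℝ) : EReal :=
  -⨅ r ∈ Icc (0 : ℝ) 1, log2 (ENNReal.ofReal (∑ y, P₁ y ^ r * P₂ y ^ (1 - r)))

/-- The minimum Chernoff information between the laws of `Y` given distinct inputs. -/
noncomputable def minChernoff {X Y : Type*} [Fintype Y] (W : X → Y → ℝ) : EReal :=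
  ⨅ (x : X) (x' : X) (_ : x ≠ x'), chernoffInfo (W x) (W x')

/-! Write κ(x,z) for the Chernoff coefficient, the minimum over `r` of `∑ P ^ r * Q ^ (1 - r)` on
the common support, and let the pair error of `x` and `z` be the sum over `y` of the smaller of
their joint probabilities. Pair errors are at most κ^n, and for κ > 0 at least a constant times (κ
e^(-δ))^n eventually, for every δ > 0. Both bounds on the distance reduce to pair errors.

Upper bound: coupling `X` with its posterior bounds the L¹ distance of the CDFs by E|L_n - I_X|.
Smoothness at `E_x` and compactness give |f(P) - f(E_x)| ≤ A (1 - P x), and the mean of 1 - P x is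
controlled by pair errors (`exists_eLpNorm_le`).

Lower bound: the L¹ norm dominates the integral over (v - δ, v], v = f(E_b), which equals E g(I_X) -
E g(L_n) for the ramp g rising from 0 to δ on that interval. The derivative property makes the
leakage drop linearly near the extreme points of level v. Elsewhere on the face spanned by
realisations no more informative than `b`, strict local maximality and the mixture bound keep it
below v. Hence (`exists_separation`) the integral is at least δ times the pair error of (b,z), minus
a multiple of the pair errors involving more informative realisations. If (b,z) maximises κ and,
among maximisers, f(E_b), those have strictly smaller exponential rates and are negligible. -/

/-! ### Geometry of the simplex near its extreme points -/

section Simplex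

variable {X : Type*} [Fintype X] [DecidableEq X]

theorem extremePt_mem_stdSimplex (x : X) : extremePt x ∈ stdSimplex ℝ X :=
  single_mem_stdSimplex ℝ x

theorem stdSimplex_sum_erase {P : X → ℝ} (hP : P ∈ stdSimplex ℝ X) (x : X) :
    ∑ z ∈ Finset.univ.erase x, P z = 1 - P x := by
  rw [← hP.2, ← Finset.add_sum_erase _ _ (Finset.mem_univ x)]
  ring

theorem stdSimplex_apply_le_one_sub {P : X → ℝ} (hP : P ∈ stdSimplex ℝ X) {x z : X}
    (h : z ≠ x) : P z ≤ 1 - P x := by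
  rw [← stdSimplex_sum_erase hP x]
  exact Finset.single_le_sum (f := P) (fun i _ => hP.1 i) (by simp [h])

theorem stdSimplex_apply_le_one {P : X → ℝ} (hP : P ∈ stdSimplex ℝ X) (x : X) : P x ≤ 1 := by
  have := stdSimplex_sum_erase hP x
  have h0 : 0 ≤ ∑ z ∈ Finset.univ.erase x, P z := Finset.sum_nonneg fun i _ => hP.1 i
  linarith

theorem norm_sub_extremePt_le {P : X → ℝ} (hP : P ∈ stdSimplex ℝ X) (x : X) :
    ‖P - extremePt x‖ ≤ 1 - P x := by
  have h1 := stdSimplex_apply_le_one hP x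
  rw [pi_norm_le_iff_of_nonneg (by linarith)]
  intro z
  by_cases h : z = x
  · subst h
    simp only [extremePt, Pi.sub_apply, Pi.single_eq_same, Real.norm_eq_abs]
    rw [abs_sub_comm, abs_of_nonneg (by linarith)]
  · simp only [extremePt, Pi.sub_apply, Pi.single_eq_of_ne h, sub_zero, Real.norm_eq_abs]
    rw [abs_of_nonneg (hP.1 z)]
    exact stdSimplex_apply_le_one_sub hP h

theorem stdSimplex_apply_lt_one {P : X → ℝ} (hP : P ∈ stdSimplex ℝ X) {x : X}
    (h : P ≠ extremePt x) : P x < 1 := by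
  by_contra h1
  have h2 := norm_sub_extremePt_le hP x
  have h3 : ‖P - extremePt x‖ = 0 := le_antisymm (by linarith) (norm_nonneg _)
  exact h (sub_eq_zero.1 (norm_eq_zero.1 h3))

/-- Expands a displacement from a vertex as a nonnegative combination of edge directions, so that
derivative bounds need checking only along edges. -/
theorem sub_extremePt_eq_sum {P : X → ℝ} (hP : P ∈ stdSimplex ℝ X) (x : X) :
    P - extremePt x = ∑ z ∈ Finset.univ.erase x, P z • (extremePt z - extremePt x) := by
  have h : ∑ z ∈ Finset.univ.erase x, P z • (extremePt z - extremePt x)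
      = ∑ z, P z • (extremePt z - extremePt x) := by
    rw [← Finset.add_sum_erase _ _ (Finset.mem_univ x)]
    simp
  rw [h]
  simp only [smul_sub, Finset.sum_sub_distrib, ← Finset.sum_smul, hP.2, one_smul]
  congr 1
  ext i
  simp [extremePt, Finset.sum_apply, Pi.single_apply]

end Simplex

/-! ### Local and global bounds on the leakage function -/

section Leakage

variable {X : Type*} [Fintype X] [DecidableEq X] {f : (X → ℝ) → (X → ℝ) → ℝ} {Q : X → ℝ}

namespace IsPointwiseLeakage

theorem continuousOn_left (hf : IsPointwiseLeakage f) (hQ : Q ∈ fullSupport X) :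
    ContinuousOn (fun P => f P Q) (stdSimplex ℝ X) :=
  hf.continuousOn.comp (f := fun P => (P, Q)) (by fun_prop) fun P hP => ⟨hP, hQ⟩

theorem differentiableAt (hf : IsPointwiseLeakage f) (hQ : Q ∈ fullSupport X) (x : X) :
    DifferentiableAt ℝ (fun P => f P Q) (extremePt x) := by
  obtain ⟨U, hU, h⟩ := hf.smooth Q hQ x
  exact (h.contDiffAt hU).differentiableAt (by simp)

theorem exists_abs_sub_le_at (hf : IsPointwiseLeakage f) (hQ : Q ∈ fullSupport X) (x : X) :
    ∃ A : ℝ, 0 ≤ A ∧ ∀ P ∈ stdSimplex ℝ X, |f P Q - f (extremePt x) Q| ≤ A * (1 - P x) := by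
  -- Membership in the simplex is repeated inside the predicate because compactness induction
  -- applies it to arbitrary sets.
  have key : ∃ A : ℝ, 0 ≤ A ∧ ∀ P ∈ stdSimplex ℝ X, P ∈ stdSimplex ℝ X →
      |f P Q - f (extremePt x) Q| ≤ A * (1 - P x) := by
    refine (isCompact_stdSimplex ℝ X).induction_on
      (p := fun s => ∃ A : ℝ, 0 ≤ A ∧ ∀ P ∈ s, P ∈ stdSimplex ℝ X →
        |f P Q - f (extremePt x) Q| ≤ A * (1 - P x)) ⟨0, le_rfl, by simp⟩ ?_ ?_ ?_
    · rintro s t hst ⟨A, hA, h⟩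
      exact ⟨A, hA, fun P hP => h P (hst hP)⟩
    · rintro s t ⟨A, hA, h⟩ ⟨B, hB, h'⟩
      refine ⟨max A B, le_max_of_le_left hA, ?_⟩
      rintro P (hP | hP) hPs
      · exact (h P hP hPs).trans (mul_le_mul_of_nonneg_right (le_max_left _ _)
          (sub_nonneg.2 (stdSimplex_apply_le_one hPs x)))
      · exact (h' P hP hPs).trans (mul_le_mul_of_nonneg_right (le_max_right _ _)
          (sub_nonneg.2 (stdSimplex_apply_le_one hPs x)))
    · intro P₀ hP₀
      by_cases hx : P₀ = extremePt x
      · subst hx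
        obtain ⟨A, hA, h⟩ :=
          (hf.differentiableAt hQ x).hasFDerivAt.isBigO_sub.exists_nonneg
        refine ⟨_, mem_nhdsWithin_of_mem_nhds h.bound, A, hA, fun P hP hPs => ?_⟩
        exact le_trans hP (mul_le_mul_of_nonneg_left (norm_sub_extremePt_le hPs x) hA)
      · have h1 := stdSimplex_apply_lt_one hP₀ hx
        have hc : ContinuousWithinAt (fun P => |f P Q - f (extremePt x) Q|)
            (stdSimplex ℝ X) P₀ :=
          ((hf.continuousOn_left hQ P₀ hP₀).sub continuousWithinAt_const).abs
        -- Away from `E_x` the factor `1 - P x` is bounded below, so local boundedness of `f`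
        -- suffices.
        have e1 := hc.eventually_lt continuousWithinAt_const (lt_add_one _)
        have hd : ContinuousWithinAt (fun P : X → ℝ => P x) (stdSimplex ℝ X) P₀ :=
          (continuous_apply x).continuousWithinAt
        have e2 := hd.eventually_lt continuousWithinAt_const
          (show P₀ x < (1 + P₀ x) / 2 by linarith)
        refine ⟨_, e1.and e2, (|f P₀ Q - f (extremePt x) Q| + 1) / ((1 - P₀ x) / 2),
          div_nonneg (by positivity) (by linarith), ?_⟩
        rintro P ⟨hP1, hP2⟩ hPs
        rw [div_mul_eq_mul_div, le_div_iff₀ (by linarith)]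
        exact mul_le_mul hP1.le (by linarith) (by linarith) (by positivity)
  obtain ⟨A, hA, h⟩ := key
  exact ⟨A, hA, fun P hP => h P hP hP⟩

/-- The leakage is Lipschitz at the extreme points, uniformly over the simplex. -/
theorem exists_abs_sub_le (hf : IsPointwiseLeakage f) (hQ : Q ∈ fullSupport X) :
    ∃ A : ℝ, 0 ≤ A ∧ ∀ x, ∀ P ∈ stdSimplex ℝ X,
      |f P Q - f (extremePt x) Q| ≤ A * (1 - P x) := by
  choose A hA h using fun x => hf.exists_abs_sub_le_at hQ x
  refine ⟨∑ x, A x, Finset.sum_nonneg fun x _ => hA x, fun x P hP => (h x P hP).trans ?_⟩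
  exact mul_le_mul_of_nonneg_right
    (Finset.single_le_sum (f := A) (fun i _ => hA i) (Finset.mem_univ x))
    (sub_nonneg.2 (stdSimplex_apply_le_one hP x))

/-- The derivative is at most some `-c < 0` on the finitely many edges, hence at most `-c * (1 - P
x)` on displacements. As `1 - P x` dominates the sup norm of the displacement, the first-order error
costs only half of this. -/
theorem exists_mul_le_sub_at (hf : IsPointwiseLeakage f) (hQ : Q ∈ fullSupport X)
    (hd : HasDerivativeProperty f Q) (x : X) :
    ∃ c : ℝ, 0 < c ∧ ∀ᶠ P in 𝓝 (extremePt x), P ∈ stdSimplex ℝ X →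
      c * (1 - P x) ≤ f (extremePt x) Q - f P Q := by
  set D := fderiv ℝ (fun P => f P Q) (extremePt x) with hD
  obtain ⟨c, hc, hcD⟩ : ∃ c : ℝ, 0 < c ∧
      ∀ z ∈ Finset.univ.erase x, D (extremePt z - extremePt x) ≤ -c := by
    have hneg : ∀ z ∈ Finset.univ.erase x, 0 < -D (extremePt z - extremePt x) := by
      intro z hz
      have hzx : z ≠ x := Finset.ne_of_mem_erase hz
      have := hd x (extremePt z) (extremePt_mem_stdSimplex z) (by
        intro h
        have := congrFun h z
        simp [extremePt, hzx] at this)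
      simpa [hD] using this
    rcases (Finset.univ.erase x).eq_empty_or_nonempty with h | h
    · exact ⟨1, one_pos, by simp [h]⟩
    · obtain ⟨z, hz, hm⟩ :=
        Finset.exists_min_image _ (fun z => -D (extremePt z - extremePt x)) h
      exact ⟨_, hneg z hz, fun w hw => by linarith [hm w hw]⟩
  refine ⟨c / 2, by positivity, ?_⟩
  have ho := ((hf.differentiableAt hQ x).hasFDerivAt.isLittleO).def
    (show 0 < c / 2 by positivity)
  filter_upwards [ho] with P hP hPs
  have h1 : D (P - extremePt x) ≤ -c * (1 - P x) := by
    rw [sub_extremePt_eq_sum hPs x, map_sum, ← stdSimplex_sum_erase hPs x, Finset.mul_sum]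
    refine Finset.sum_le_sum fun z hz => ?_
    rw [map_smul, smul_eq_mul, mul_comm (-c)]
    exact mul_le_mul_of_nonneg_left (hcD z hz) (hPs.1 z)
  have h2 := (le_abs_self _).trans
    (hP.trans (mul_le_mul_of_nonneg_left (norm_sub_extremePt_le hPs x) (by positivity)))
  simp only [← hD] at h2
  linarith

theorem exists_mul_le_sub (hf : IsPointwiseLeakage f) (hQ : Q ∈ fullSupport X)
    (hd : HasDerivativeProperty f Q) [Nonempty X] :
    ∃ c : ℝ, 0 < c ∧ ∀ x, ∀ᶠ P in 𝓝 (extremePt x), P ∈ stdSimplex ℝ X →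
      c * (1 - P x) ≤ f (extremePt x) Q - f P Q := by
  choose c hc h using fun x => hf.exists_mul_le_sub_at hQ hd x
  obtain ⟨x₀, -, hx₀⟩ := Finset.exists_min_image Finset.univ c Finset.univ_nonempty
  refine ⟨c x₀, hc x₀, fun x => ?_⟩
  filter_upwards [h x] with P hP hPs
  exact (mul_le_mul_of_nonneg_right (hx₀ x (Finset.mem_univ x))
    (sub_nonneg.2 (stdSimplex_apply_le_one hPs x))).trans (hP hPs)

theorem exists_le_of_mixture (hf : IsPointwiseLeakage f) (hQ : Q ∈ fullSupport X) [Nonempty X]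
    (P : X → X → ℝ) (c : X → ℝ) (hP : ∀ x, P x ∈ stdSimplex ℝ X) (hc : c ∈ stdSimplex ℝ X) :
    ∃ x, f (∑ x, c x • P x) Q ≤ f (P x) Q := by
  let e := (Fintype.equivFin X).symm
  have h := hf.mixture_le Q hQ _ (fun i => P (e i)) (fun i => c (e i)) (fun i => hP _)
    (fun i => hc.1 _) (by rw [e.sum_comp c, hc.2])
  rw [e.sum_comp (fun x => c x • P x)] at h
  have : Nonempty (Fin (Fintype.card X)) := e.symm.nonempty_congr.1 inferInstance
  obtain ⟨i, hi⟩ := exists_eq_ciSup_of_finite (f := fun i => f (P (e i)) Q)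
  exact ⟨e i, h.trans_eq hi.symm⟩

/-- The leakage at a posterior that is not an extreme point is smaller than at the worst extreme
point of its face. -/
theorem lt_of_forall_ne_extremePt (hf : IsPointwiseLeakage f) (hQ : Q ∈ fullSupport X)
    {P : X → ℝ} (hP : P ∈ stdSimplex ℝ X) (hne : ∀ x, P ≠ extremePt x) {b : X}
    (hface : ∀ x, f (extremePt b) Q < f (extremePt x) Q → P x = 0) :
    f P Q < f (extremePt b) Q := by
  have : Nonempty X := ⟨b⟩
  -- Pulling every vertex slightly towards `P` gives points with the same mixture `P`, each strictly
  -- below its vertex by strict local maximality.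
  let R : ℝ → X → X → ℝ := fun ε x => (1 - ε) • extremePt x + ε • P
  have hRs : ∀ ε ∈ Ioo (0 : ℝ) 1, ∀ x, R ε x ∈ stdSimplex ℝ X := fun ε hε x =>
    convex_stdSimplex ℝ X (extremePt_mem_stdSimplex x) hP (by linarith [hε.2]) hε.1.le (by ring)
  have hRne : ∀ ε ∈ Ioo (0 : ℝ) 1, ∀ x, R ε x ≠ extremePt x := by
    intro ε hε x h
    have h1 : ε • (P - extremePt x) = 0 := by
      have : ε • (P - extremePt x) = R ε x - extremePt x := by
        simp only [R, smul_sub, sub_smul, one_smul]; abel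
      rw [this, h, sub_self]
    rcases smul_eq_zero.1 h1 with h2 | h2
    · exact hε.1.ne' h2
    · exact hne x (sub_eq_zero.1 h2)
  have hlim : ∀ x, Tendsto (fun ε => R ε x) (𝓝[>] 0)
      (𝓝[stdSimplex ℝ X \ {extremePt x}] (extremePt x)) := by
    intro x
    refine tendsto_nhdsWithin_iff.2 ⟨?_, ?_⟩
    · have hc : Continuous fun ε => R ε x := by fun_prop
      have := hc.tendsto 0
      simp only [R, sub_zero, one_smul, zero_smul, add_zero] at this
      exact this.mono_left nhdsWithin_le_nhds
    · filter_upwards [Ioo_mem_nhdsGT one_pos] with ε hε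
      exact ⟨hRs ε hε x, hRne ε hε x⟩
  have hev : ∀ᶠ ε in 𝓝[>] (0 : ℝ), ∀ x, f (R ε x) Q < f (extremePt x) Q :=
    eventually_all.2 fun x => (hlim x).eventually (hf.strict_local_max Q hQ x)
  obtain ⟨ε, hε, hεI⟩ := (hev.and (Ioo_mem_nhdsGT one_pos)).exists
  -- The mixture bound takes the maximum over all components, even those of weight zero; these are
  -- replaced by the one at `b` so that vertices outside the face do not enter.
  let S : X → X → ℝ := fun x => if P x = 0 then R ε b else R ε x
  obtain ⟨x, hx⟩ := hf.exists_le_of_mixture hQ S P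
    (fun x => by simp only [S]; split_ifs <;> exact hRs ε hεI _) hP
  have hsum : ∑ x, P x • S x = P := by
    have h1 : ∀ x, P x • S x = P x • R ε x := by
      intro x
      simp only [S]
      split_ifs with h
      · simp [h]
      · rfl
    simp only [h1, R, smul_add, Finset.sum_add_distrib, ← Finset.sum_smul, hP.2, one_smul]
    have h2 : ∑ x, P x • (1 - ε) • extremePt x = (1 - ε) • P := by
      ext i
      simp [extremePt, Finset.sum_apply, Pi.single_apply, mul_comm]
    rw [h2, ← add_smul]
    simp
  rw [hsum] at hx
  refine hx.trans_lt ?_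
  simp only [S]
  split_ifs with h
  · exact hε b
  · exact (hε x).trans_le (not_lt.1 fun h' => h (hface x h'))

theorem le_of_face (hf : IsPointwiseLeakage f) (hQ : Q ∈ fullSupport X)
    {P : X → ℝ} (hP : P ∈ stdSimplex ℝ X) {b : X}
    (hface : ∀ x, f (extremePt b) Q < f (extremePt x) Q → P x = 0) :
    f P Q ≤ f (extremePt b) Q := by
  by_cases hne : ∃ x, P = extremePt x
  · obtain ⟨x, rfl⟩ := hne
    by_contra! h
    have := hface x h
    simp [extremePt] at this
  · push Not at hne
    exact (hf.lt_of_forall_ne_extremePt hQ hP hne hface).le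

/-- The test function `t ↦ min δ (t - (v - δ))⁺` at the level `v = f (E_b, Q)` separates the
posterior leakage from the information of the posterior's extreme points, up to confusion with
more informative realisations. -/
theorem exists_separation (hf : IsPointwiseLeakage f) (hQ : Q ∈ fullSupport X)
    (hd : HasDerivativeProperty f Q) (b : X) :
    ∃ δ C : ℝ, 0 < δ ∧ 0 ≤ C ∧ ∀ P ∈ stdSimplex ℝ X, ∀ z, z ≠ b →
      δ * min (P b) (P z) ≤
        δ * (∑ x, if f (extremePt b) Q ≤ f (extremePt x) Q then P x else 0)
        - min δ (max 0 (f P Q - f (extremePt b) Q + δ))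
        + C * ∑ u, if f (extremePt b) Q < f (extremePt u) Q then
            ∑ w ∈ Finset.univ.erase u, min (P u) (P w) else 0 := by
  have : Nonempty X := ⟨b⟩
  set v := f (extremePt b) Q with hv
  obtain ⟨c, hc, hcev⟩ := hf.exists_mul_le_sub hQ hd
  choose t htP hto htx using fun x => eventually_nhds_iff.1 (hcev x)
  -- The compact part of the face on which `f` stays uniformly below `v`: neighbourhoods of the
  -- vertices of level exactly `v` are removed.
  let K : Set (X → ℝ) := stdSimplex ℝ X ∩
    ({P | ∀ u, v < f (extremePt u) Q → P u = 0} ∩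
      (⋃ x ∈ {x | f (extremePt x) Q = v}, t x)ᶜ)
  have hKc : IsCompact K := by
    refine (isCompact_stdSimplex ℝ X).inter_right (IsClosed.inter ?_ ?_)
    · simp only [Set.ofPred_forall]
      exact isClosed_iInter fun u => isClosed_iInter fun _ =>
        isClosed_eq (continuous_apply u) continuous_const
    · exact (isOpen_biUnion fun x _ => hto x).isClosed_compl
  have hKlt : ∀ P ∈ K, f P Q < v := by
    rintro P ⟨hPs, hPU, hPt⟩
    by_cases hne : ∃ x, P = extremePt x
    · obtain ⟨x, rfl⟩ := hne
      refine lt_of_le_of_ne (hf.le_of_face hQ hPs hPU) fun h => hPt ?_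
      exact mem_biUnion (show x ∈ {x | f (extremePt x) Q = v} from h) (htx x)
    · push Not at hne
      exact hf.lt_of_forall_ne_extremePt hQ hPs hne hPU
  obtain ⟨M, hMv, hM⟩ : ∃ M < v, ∀ P ∈ K, f P Q ≤ M := by
    obtain ⟨M, h1, h2⟩ := hKc.exists_forall_le'
      ((hf.continuousOn_left hQ).mono inter_subset_left).neg fun P hP => neg_lt_neg (hKlt P hP)
    exact ⟨-M, by linarith, fun P hP => le_neg_of_le_neg (h2 P hP)⟩
  -- The bound `c / 2` lets the linear drop near vertices of level `v` absorb the ramp; `(v - M) /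
  -- 2` makes the ramp vanish near `K`.
  let δ := min (c / 2) ((v - M) / 2)
  have hδ : 0 < δ := lt_min (by positivity) (by linarith)
  have hδc : δ ≤ c / 2 := min_le_left _ _
  have hδM : δ ≤ (v - M) / 2 := min_le_right _ _
  clear_value δ
  let B : (X → ℝ) → ℝ := fun P => ∑ x, if v ≤ f (extremePt x) Q then P x else 0
  let N : (X → ℝ) → ℝ := fun P => ∑ u, if v < f (extremePt u) Q then
    ∑ w ∈ Finset.univ.erase u, min (P u) (P w) else 0
  have hBle : ∀ P ∈ stdSimplex ℝ X, ∀ x, v ≤ f (extremePt x) Q → P x ≤ B P := by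
    intro P hP x hx
    have := Finset.single_le_sum (f := fun x => if v ≤ f (extremePt x) Q then P x else 0)
      (s := Finset.univ) (fun i _ => by split_ifs; exacts [hP.1 i, le_rfl])
      (Finset.mem_univ x)
    rwa [if_pos hx] at this
  have hNle : ∀ P ∈ stdSimplex ℝ X, ∀ u, v < f (extremePt u) Q →
      ∑ w ∈ Finset.univ.erase u, min (P u) (P w) ≤ N P := by
    intro P hP u hu
    have := Finset.single_le_sum (f := fun u => if v < f (extremePt u) Q then
      ∑ w ∈ Finset.univ.erase u, min (P u) (P w) else 0)
      (s := Finset.univ) (fun i _ => by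
        split_ifs
        exacts [Finset.sum_nonneg fun w _ => le_min (hP.1 _) (hP.1 _), le_rfl])
      (Finset.mem_univ u)
    rwa [if_pos hu] at this
  have hN0 : ∀ P ∈ stdSimplex ℝ X, 0 ≤ N P := fun P hP => Finset.sum_nonneg fun u _ => by
    split_ifs
    exacts [Finset.sum_nonneg fun w _ => le_min (hP.1 _) (hP.1 _), le_rfl]
  have hmin : ∀ P ∈ stdSimplex ℝ X, ∀ z, z ≠ b → ∀ x, min (P b) (P z) ≤ 1 - P x := by
    intro P hP z hz x
    by_cases h : b = x
    · exact (min_le_right _ _).trans (stdSimplex_apply_le_one_sub hP (h ▸ hz))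
    · exact (min_le_left _ _).trans (stdSimplex_apply_le_one_sub hP h)
  have key : ∃ C : ℝ, 0 ≤ C ∧ ∀ P ∈ stdSimplex ℝ X, P ∈ stdSimplex ℝ X → ∀ z, z ≠ b →
      δ * min (P b) (P z) ≤ δ * B P - min δ (max 0 (f P Q - v + δ)) + C * N P := by
    refine (isCompact_stdSimplex ℝ X).induction_on
      (p := fun s => ∃ C : ℝ, 0 ≤ C ∧ ∀ P ∈ s, P ∈ stdSimplex ℝ X → ∀ z, z ≠ b →
        δ * min (P b) (P z) ≤ δ * B P - min δ (max 0 (f P Q - v + δ)) + C * N P)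
      ⟨0, le_rfl, by simp⟩ ?_ ?_ ?_
    · rintro s t hst ⟨A, hA, h⟩
      exact ⟨A, hA, fun P hP => h P (hst hP)⟩
    · rintro s t ⟨A, hA, h⟩ ⟨A', hA', h'⟩
      refine ⟨max A A', le_max_of_le_left hA, ?_⟩
      rintro P (hP | hP) hPs z hz
      · have := mul_le_mul_of_nonneg_right (le_max_left A A') (hN0 P hPs)
        linarith [h P hP hPs z hz]
      · have := mul_le_mul_of_nonneg_right (le_max_right A A') (hN0 P hPs)
        linarith [h' P hP hPs z hz]
    · intro P₀ hP₀
      have hlow : ∀ P ∈ stdSimplex ℝ X, f P Q ≤ v - δ → ∀ z, z ≠ b →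
          δ * min (P b) (P z) ≤ δ * B P - min δ (max 0 (f P Q - v + δ)) := by
        intro P hP h z hz
        rw [max_eq_left (by linarith), min_eq_right hδ.le, sub_zero]
        exact mul_le_mul_of_nonneg_left ((min_le_left _ _).trans (hBle P hP b le_rfl)) hδ.le
      by_cases h1 : P₀ ∈ ⋃ x ∈ {x | f (extremePt x) Q = v}, t x
      · simp only [mem_iUnion] at h1
        obtain ⟨x, hx, hxt⟩ := h1
        simp only [Set.mem_ofPred_eq] at hx
        refine ⟨t x, mem_nhdsWithin_of_mem_nhds ((hto x).mem_nhds hxt), 0, le_rfl, ?_⟩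
        intro P hP hPs z hz
        rw [zero_mul, add_zero]
        rcases le_total (f P Q) (v - δ) with h | h
        · exact hlow P hPs h z hz
        · have h2 := htP x P hP hPs
          rw [hx] at h2
          have h3 := hmin P hPs z hz x
          have h4 := hBle P hPs x hx.ge
          have h5 : 0 ≤ 1 - P x := sub_nonneg.2 (stdSimplex_apply_le_one hPs x)
          have h6 : min δ (max 0 (f P Q - v + δ)) ≤ f P Q - v + δ := by
            rw [max_eq_right (by linarith)]
            exact min_le_right _ _
          have h7 := mul_le_mul_of_nonneg_left h3 hδ.le
          have h8 := mul_le_mul_of_nonneg_left h4 hδ.le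
          have h9 := mul_le_mul_of_nonneg_right hδc h5
          linarith
      by_cases h2 : ∀ u, v < f (extremePt u) Q → P₀ u = 0
      · have hPK : P₀ ∈ K := ⟨hP₀, h2, h1⟩
        have e := (hf.continuousOn_left hQ P₀ hP₀).eventually_lt continuousWithinAt_const
          (show f P₀ Q < v - δ by linarith [hM P₀ hPK])
        refine ⟨_, e, 0, le_rfl, fun P hP hPs z hz => ?_⟩
        rw [zero_mul, add_zero]
        exact hlow P hPs (le_of_lt hP) z hz
      push Not at h2
      obtain ⟨u, hu, hPu⟩ := h2
      have hPu' : 0 < P₀ u := lt_of_le_of_ne (hP₀.1 u) hPu.symm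
      by_cases h3 : P₀ = extremePt u
      · have hcu : ContinuousWithinAt (fun P : X → ℝ => P u) (stdSimplex ℝ X) P₀ :=
          (continuous_apply u).continuousWithinAt
        have e := continuousWithinAt_const.eventually_lt hcu
          (show (1 / 2 : ℝ) < P₀ u by rw [h3]; norm_num [extremePt])
        -- One `δ * (1 - P u)` compensates the loss in `δ * B P - δ`, the other pays for the left
        -- side.
        refine ⟨_, e, 2 * δ, by positivity, fun P hP hPs z hz => ?_⟩
        have hP : 1 / 2 < P u := hP
        have h4 : 1 - P u ≤ N P := by
          refine le_trans (le_of_eq ?_) (hNle P hPs u hu)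
          rw [← stdSimplex_sum_erase hPs u]
          refine Finset.sum_congr rfl fun w hw => (min_eq_right ?_).symm
          linarith [stdSimplex_apply_le_one_sub hPs (Finset.ne_of_mem_erase hw)]
        have h5 := mul_le_mul_of_nonneg_left (hmin P hPs z hz u) hδ.le
        have h6 := mul_le_mul_of_nonneg_left (hBle P hPs u hu.le) hδ.le
        have h7 := min_le_left δ (max 0 (f P Q - v + δ))
        have h8 := mul_le_mul_of_nonneg_left h4 hδ.le
        linarith
      -- Here `N` is bounded away from zero near `P₀`, so a large constant outweighs all the other
      -- terms, which are of size `δ`.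
      · have h4 := stdSimplex_apply_lt_one hP₀ h3
        obtain ⟨w, hw, hPw⟩ : ∃ w ∈ Finset.univ.erase u, 0 < P₀ w := by
          by_contra! h
          have := Finset.sum_nonpos h
          rw [stdSimplex_sum_erase hP₀ u] at this
          linarith
        have hcm : ContinuousWithinAt (fun P : X → ℝ => min (P u) (P w)) (stdSimplex ℝ X) P₀ :=
          ((continuous_apply u).min (continuous_apply w)).continuousWithinAt
        have hm : 0 < min (P₀ u) (P₀ w) := lt_min hPu' hPw
        set m := min (P₀ u) (P₀ w)
        have e := continuousWithinAt_const.eventually_lt hcm (half_lt_self hm)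
        refine ⟨_, e, 2 * δ / (m / 2), by positivity, fun P hP hPs z hz => ?_⟩
        have hP : m / 2 < min (P u) (P w) := hP
        have h5 : m / 2 ≤ N P := hP.le.trans <|
          (Finset.single_le_sum (f := fun w => min (P u) (P w))
            (fun i _ => le_min (hPs.1 _) (hPs.1 _)) hw).trans (hNle P hPs u hu)
        have h6 : 2 * δ ≤ 2 * δ / (m / 2) * N P := by
          rw [div_mul_eq_mul_div, le_div_iff₀ (by positivity)]
          exact mul_le_mul_of_nonneg_left h5 (by positivity)
        have h7 := min_le_left δ (max 0 (f P Q - v + δ))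
        have h8 : δ * min (P b) (P z) ≤ δ * 1 := mul_le_mul_of_nonneg_left
          ((min_le_left _ _).trans (stdSimplex_apply_le_one hPs b)) hδ.le
        have h9 := mul_nonneg hδ.le ((hPs.1 b).trans (hBle P hPs b le_rfl))
        linarith
  obtain ⟨C, hC, h⟩ := key
  exact ⟨δ, C, hδ, hC, fun P hP => h P hP hP⟩

end IsPointwiseLeakage

end Leakage

/-! ### Joint probabilities, posteriors and pair errors -/

section Joint

variable {X Y : Type*} [Fintype X] [Fintype Y] {QX : X → ℝ} {W : X → Y → ℝ}

/-- `∑_{y^n} min (Pr{X = x, Y^n = y^n}) (Pr{X = z, Y^n = y^n})`, the Bayes error for testing `x`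
against `z`. -/
noncomputable def pairError {X Y : Type*} [Fintype Y] (QX : X → ℝ) (W : X → Y → ℝ) (n : ℕ)
    (x z : X) : ℝ :=
  ∑ y : Fin n → Y, min (jointProb QX W n x y) (jointProb QX W n z y)

theorem jointProb_nonneg (hQ : QX ∈ stdSimplex ℝ X) (hW : ∀ x, W x ∈ stdSimplex ℝ Y)
    (n : ℕ) (x : X) (y : Fin n → Y) : 0 ≤ jointProb QX W n x y :=
  mul_nonneg (hQ.1 x) (Finset.prod_nonneg fun i _ => (hW x).1 (y i))

theorem sum_jointProb {X Y : Type*} [Fintype Y] {QX : X → ℝ} {W : X → Y → ℝ}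
    (hW : ∀ x, W x ∈ stdSimplex ℝ Y) (n : ℕ) (x : X) :
    ∑ y : Fin n → Y, jointProb QX W n x y = QX x := by
  simp only [jointProb, ← Finset.mul_sum]
  rw [← Fintype.sum_pow, (hW x).2, one_pow, mul_one]

theorem outputProb_nonneg (hQ : QX ∈ stdSimplex ℝ X) (hW : ∀ x, W x ∈ stdSimplex ℝ Y)
    (n : ℕ) (y : Fin n → Y) : 0 ≤ outputProb QX W n y :=
  Finset.sum_nonneg fun x _ => jointProb_nonneg hQ hW n x y

theorem sum_outputProb (hQ : QX ∈ stdSimplex ℝ X) (hW : ∀ x, W x ∈ stdSimplex ℝ Y) (n : ℕ) :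
    ∑ y : Fin n → Y, outputProb QX W n y = 1 := by
  simp only [outputProb]
  rw [Finset.sum_comm]
  simp only [sum_jointProb hW, hQ.2]

theorem jointProb_le_outputProb (hQ : QX ∈ stdSimplex ℝ X) (hW : ∀ x, W x ∈ stdSimplex ℝ Y)
    (n : ℕ) (x : X) (y : Fin n → Y) : jointProb QX W n x y ≤ outputProb QX W n y :=
  Finset.single_le_sum (f := fun x => jointProb QX W n x y)
    (fun x _ => jointProb_nonneg hQ hW n x y) (Finset.mem_univ x)

theorem posterior_mem_stdSimplex (hQ : QX ∈ stdSimplex ℝ X) (hW : ∀ x, W x ∈ stdSimplex ℝ Y)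
    {n : ℕ} {y : Fin n → Y} (hy : outputProb QX W n y ≠ 0) :
    posterior QX W n y ∈ stdSimplex ℝ X := by
  refine ⟨fun x => div_nonneg (jointProb_nonneg hQ hW n x y) (outputProb_nonneg hQ hW n y), ?_⟩
  simp only [posterior, ← Finset.sum_div]
  exact div_self hy

/-- Holds also for outputs of probability zero, where the posterior is a default value but the joint
probability vanishes too; averages thus need no case distinction. -/
theorem outputProb_mul_posterior (hQ : QX ∈ stdSimplex ℝ X) (hW : ∀ x, W x ∈ stdSimplex ℝ Y)
    (n : ℕ) (x : X) (y : Fin n → Y) :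
    outputProb QX W n y * posterior QX W n y x = jointProb QX W n x y := by
  by_cases hy : outputProb QX W n y = 0
  · have := jointProb_le_outputProb hQ hW n x y
    have := jointProb_nonneg hQ hW n x y
    rw [hy, zero_mul]
    linarith
  · exact mul_div_cancel₀ _ hy

theorem outputProb_mul_min_posterior (hQ : QX ∈ stdSimplex ℝ X)
    (hW : ∀ x, W x ∈ stdSimplex ℝ Y) (n : ℕ) (x z : X) (y : Fin n → Y) :
    outputProb QX W n y * min (posterior QX W n y x) (posterior QX W n y z)
      = min (jointProb QX W n x y) (jointProb QX W n z y) := by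
  rw [mul_min_of_nonneg _ _ (outputProb_nonneg hQ hW n y), outputProb_mul_posterior hQ hW,
    outputProb_mul_posterior hQ hW]

theorem jointProb_mul_posterior_le_min (hQ : QX ∈ stdSimplex ℝ X)
    (hW : ∀ x, W x ∈ stdSimplex ℝ Y) (n : ℕ) (x z : X) (y : Fin n → Y) :
    jointProb QX W n x y * posterior QX W n y z
      ≤ min (jointProb QX W n x y) (jointProb QX W n z y) := by
  by_cases hy : outputProb QX W n y = 0
  · rw [← outputProb_mul_posterior hQ hW, ← outputProb_mul_posterior hQ hW, hy]
    simp
  · have hp := posterior_mem_stdSimplex hQ hW hy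
    rw [← outputProb_mul_min_posterior hQ hW, ← outputProb_mul_posterior hQ hW n x, mul_assoc]
    classical
    have h1 := stdSimplex_apply_le_one hp x
    have h2 := stdSimplex_apply_le_one hp z
    exact mul_le_mul_of_nonneg_left
      (le_min (mul_le_of_le_one_right (hp.1 x) h2) (mul_le_of_le_one_left (hp.1 z) h1))
      (outputProb_nonneg hQ hW n y)

end Joint

/-! ### Integrals of step functions -/

section StepFunctions

theorem lintegral_enorm_step_sub_step_le {p : ℝ} (hp : 0 ≤ p) (a b : ℝ) :
    ∫⁻ l : ℝ, ‖(if a ≤ l then p else 0) - (if b ≤ l then p else 0)‖ₑ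
      ≤ ENNReal.ofReal (p * |a - b|) := by
  calc ∫⁻ l : ℝ, ‖(if a ≤ l then p else 0) - (if b ≤ l then p else 0)‖ₑ
      ≤ ∫⁻ l : ℝ, (uIcc a b).indicator (fun _ => ENNReal.ofReal p) l := by
        refine lintegral_mono fun l => ?_
        by_cases h1 : a ≤ l <;> by_cases h2 : b ≤ l
        · simp [h1, h2]
        · have : l ∈ uIcc a b := mem_uIcc_of_le h1 (not_le.1 h2).le
          simp [h1, h2, this, Real.enorm_of_nonneg hp]
        · have : l ∈ uIcc a b := mem_uIcc_of_ge h2 (not_le.1 h1).le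
          simp [h1, h2, this, Real.enorm_of_nonneg hp]
        · simp [h1, h2]
    _ = ENNReal.ofReal (p * |a - b|) := by
        rw [lintegral_indicator measurableSet_uIcc, setLIntegral_const, Real.volume_interval,
          ← ENNReal.ofReal_mul hp, abs_sub_comm]

/-- Integrating a step at `t` over a window clamps `t` to that window; this is where the ramp comes
from. -/
theorem setIntegral_step (p a v t : ℝ) (hav : a ≤ v) :
    ∫ l in Ioc a v, (if t ≤ l then p else 0)
      = p * ((v - a) - min (v - a) (max 0 (t - a))) := by
  have h : (fun l : ℝ => if t ≤ l then p else 0) = (Ici t).indicator fun _ => p := by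
    ext l
    simp [indicator_apply]
  rw [h, setIntegral_indicator measurableSet_Ici, setIntegral_const, smul_eq_mul, mul_comm]
  congr 1
  rcases le_or_gt t a with hta | hta
  · have : Ioc a v ∩ Ici t = Ioc a v :=
      inter_eq_left.2 fun l hl => hta.trans hl.1.le
    rw [this, Real.volume_real_Ioc_of_le hav, max_eq_left (by linarith),
      min_eq_right (by linarith), sub_zero]
  · have : Ioc a v ∩ Ici t = Icc t v := by
      ext l
      simp only [mem_inter_iff, mem_Ioc, mem_Ici, mem_Icc]
      exact ⟨fun h => ⟨h.2, h.1.2⟩, fun h => ⟨⟨hta.trans_le h.1, h.2⟩, h.1⟩⟩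
    rw [this, max_eq_right (by linarith)]
    rcases le_total t v with h | h
    · rw [Real.volume_real_Icc_of_le h, min_eq_right (by linarith)]
      ring
    · rw [min_eq_left (by linarith), sub_self, measureReal_def, Real.volume_Icc,
        ENNReal.ofReal_of_nonpos (by linarith), ENNReal.toReal_zero]

theorem integrable_step (p t : ℝ) (s : Set ℝ) (hs : volume s ≠ ⊤) :
    Integrable (fun l : ℝ => if t ≤ l then p else 0) (volume.restrict s) := by
  have h : (fun l : ℝ => if t ≤ l then p else 0) = (Ici t).indicator fun _ => p := by
    ext l
    simp [indicator_apply]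
  rw [h]
  have : IsFiniteMeasure (volume.restrict s) := ⟨by simpa using hs.lt_top⟩
  exact (integrable_const p).indicator measurableSet_Ici

theorem ofReal_setIntegral_le_eLpNorm_one (F : ℝ → ℝ) (s : Set ℝ) :
    ENNReal.ofReal (∫ l in s, F l) ≤ eLpNorm F 1 volume := by
  rw [eLpNorm_one_eq_lintegral_enorm]
  calc ENNReal.ofReal (∫ l in s, F l) ≤ ‖∫ l in s, F l‖ₑ := Real.ofReal_le_enorm _
    _ ≤ ∫⁻ l in s, ‖F l‖ₑ := enorm_integral_le_lintegral_enorm _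
    _ ≤ ∫⁻ l, ‖F l‖ₑ := setLIntegral_le_lintegral _ _

end StepFunctions

/-! ### Bounds on the L¹ distance by pair errors -/

section Distance

variable {X Y : Type*} [Fintype X] [DecidableEq X] [Fintype Y] {QX : X → ℝ} {W : X → Y → ℝ}
  {f : (X → ℝ) → (X → ℝ) → ℝ}

/-- Both CDFs are written over the joint law of `X` and `Y^n`, which couples `L_n` with `I_X`. -/
theorem leakageCDF_sub_informationCDF (hW : ∀ x, W x ∈ stdSimplex ℝ Y) (n : ℕ) (l : ℝ) :
    (leakageCDF f QX W n - informationCDF f QX) l = ∑ x, ∑ y : Fin n → Y,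
      ((if f (posterior QX W n y) QX ≤ l then jointProb QX W n x y else 0)
        - (if f (extremePt x) QX ≤ l then jointProb QX W n x y else 0)) := by
  simp only [Pi.sub_apply, Finset.sum_sub_distrib]
  congr 1
  · rw [leakageCDF, Finset.sum_comm]
    refine Finset.sum_congr rfl fun y _ => ?_
    split_ifs
    · rfl
    · simp
  · rw [informationCDF]
    refine Finset.sum_congr rfl fun x _ => ?_
    split_ifs
    · rw [sum_jointProb hW]
    · simp

theorem eLpNorm_leakageCDF_sub_le (hQ : QX ∈ stdSimplex ℝ X) (hW : ∀ x, W x ∈ stdSimplex ℝ Y)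
    (n : ℕ) :
    eLpNorm (leakageCDF f QX W n - informationCDF f QX) 1 volume
      ≤ ENNReal.ofReal (∑ x, ∑ y : Fin n → Y,
        jointProb QX W n x y * |f (posterior QX W n y) QX - f (extremePt x) QX|) := by
  have h0 : ∀ x (y : Fin n → Y),
      0 ≤ jointProb QX W n x y * |f (posterior QX W n y) QX - f (extremePt x) QX| :=
    fun x y => mul_nonneg (jointProb_nonneg hQ hW n x y) (abs_nonneg _)
  have hm : ∀ (t p : ℝ), Measurable fun l : ℝ => if t ≤ l then p else 0 := fun t p =>
    Measurable.ite measurableSet_Ici measurable_const measurable_const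
  have hm' : ∀ s t p : ℝ, Measurable fun l : ℝ =>
      ‖(if s ≤ l then p else 0) - (if t ≤ l then p else 0)‖ₑ := fun s t p =>
    ((hm s p).sub (hm t p)).enorm
  rw [eLpNorm_one_eq_lintegral_enorm,
    ENNReal.ofReal_sum_of_nonneg fun x _ => Finset.sum_nonneg fun y _ => h0 x y]
  calc ∫⁻ l, ‖(leakageCDF f QX W n - informationCDF f QX) l‖ₑ
      ≤ ∫⁻ l, ∑ x, ∑ y : Fin n → Y,
        ‖(if f (posterior QX W n y) QX ≤ l then jointProb QX W n x y else 0)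
          - (if f (extremePt x) QX ≤ l then jointProb QX W n x y else 0)‖ₑ := by
        refine lintegral_mono fun l => ?_
        rw [leakageCDF_sub_informationCDF hW]
        exact (enorm_sum_le _ _).trans (Finset.sum_le_sum fun x _ => enorm_sum_le _ _)
    _ = ∑ x, ∑ y : Fin n → Y, ∫⁻ l,
        ‖(if f (posterior QX W n y) QX ≤ l then jointProb QX W n x y else 0)
          - (if f (extremePt x) QX ≤ l then jointProb QX W n x y else 0)‖ₑ := by
        rw [lintegral_finsetSum _ fun x _ => Finset.measurable_sum _ fun y _ =>
          hm' _ _ _]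
        refine Finset.sum_congr rfl fun x _ => ?_
        rw [lintegral_finsetSum _ fun y _ => hm' _ _ _]
    _ ≤ _ := by
        refine Finset.sum_le_sum fun x _ => ?_
        rw [ENNReal.ofReal_sum_of_nonneg fun y _ => h0 x y]
        exact Finset.sum_le_sum fun y _ =>
          lintegral_enorm_step_sub_step_le (jointProb_nonneg hQ hW n x y) _ _

theorem IsPointwiseLeakage.exists_eLpNorm_le (hf : IsPointwiseLeakage f)
    (hQ : QX ∈ fullSupport X) (hW : ∀ x, W x ∈ stdSimplex ℝ Y) :
    ∃ A : ℝ, 0 ≤ A ∧ ∀ n, eLpNorm (leakageCDF f QX W n - informationCDF f QX) 1 volume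
      ≤ ENNReal.ofReal (A * ∑ x, ∑ z ∈ Finset.univ.erase x, pairError QX W n x z) := by
  obtain ⟨A, hA, h⟩ := hf.exists_abs_sub_le hQ
  refine ⟨A, hA, fun n => (eLpNorm_leakageCDF_sub_le hQ.1 hW n).trans
    (ENNReal.ofReal_le_ofReal ?_)⟩
  rw [Finset.mul_sum]
  refine Finset.sum_le_sum fun x _ => ?_
  simp only [pairError]
  rw [Finset.sum_comm, Finset.mul_sum]
  refine Finset.sum_le_sum fun y _ => ?_
  have hj := jointProb_nonneg hQ.1 hW n x y
  by_cases hy : outputProb QX W n y = 0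
  · rw [← outputProb_mul_posterior hQ.1 hW, hy]
    simp only [zero_mul]
    exact mul_nonneg hA (Finset.sum_nonneg fun z _ => le_min
      le_rfl (jointProb_nonneg hQ.1 hW n z y))
  · have hp := posterior_mem_stdSimplex hQ.1 hW hy
    calc jointProb QX W n x y * |f (posterior QX W n y) QX - f (extremePt x) QX|
        ≤ jointProb QX W n x y * (A * (1 - posterior QX W n y x)) :=
          mul_le_mul_of_nonneg_left (h x _ hp) hj
      _ = A * ∑ z ∈ Finset.univ.erase x, jointProb QX W n x y * posterior QX W n y z := by
          rw [← stdSimplex_sum_erase hp x, ← Finset.mul_sum]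
          ring
      _ ≤ _ := mul_le_mul_of_nonneg_left
          (Finset.sum_le_sum fun z _ => jointProb_mul_posterior_le_min hQ.1 hW n x z y) hA

theorem setIntegral_leakageCDF_sub (hQ : QX ∈ stdSimplex ℝ X)
    (hW : ∀ x, W x ∈ stdSimplex ℝ Y) (n : ℕ) {a v : ℝ} (hav : a ≤ v) :
    ∫ l in Ioc a v, (leakageCDF f QX W n - informationCDF f QX) l
      = ∑ x, QX x * min (v - a) (max 0 (f (extremePt x) QX - a))
        - ∑ y : Fin n → Y, outputProb QX W n y *
          min (v - a) (max 0 (f (posterior QX W n y) QX - a)) := by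
  have hi : ∀ t p : ℝ, Integrable (fun l : ℝ => if t ≤ l then p else 0)
      (volume.restrict (Ioc a v)) := fun t p => integrable_step p t _ measure_Ioc_lt_top.ne
  simp only [Pi.sub_apply, leakageCDF, informationCDF]
  rw [integral_sub (integrable_finsetSum _ fun _ _ => hi _ _)
      (integrable_finsetSum _ fun _ _ => hi _ _),
    integral_finsetSum _ fun _ _ => hi _ _, integral_finsetSum _ fun _ _ => hi _ _]
  simp only [setIntegral_step _ _ _ _ hav, mul_sub _ (v - a), Finset.sum_sub_distrib,
    ← Finset.sum_mul, sum_outputProb hQ hW, hQ.2]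
  ring

theorem IsPointwiseLeakage.exists_le_eLpNorm (hf : IsPointwiseLeakage f)
    (hQ : QX ∈ fullSupport X) (hW : ∀ x, W x ∈ stdSimplex ℝ Y)
    (hd : HasDerivativeProperty f QX) (b : X) :
    ∃ δ C : ℝ, 0 < δ ∧ 0 ≤ C ∧ ∀ n, ∀ z, z ≠ b →
      ENNReal.ofReal (δ * pairError QX W n b z
        - C * ∑ u, if f (extremePt b) QX < f (extremePt u) QX then
          ∑ w ∈ Finset.univ.erase u, pairError QX W n u w else 0)
      ≤ eLpNorm (leakageCDF f QX W n - informationCDF f QX) 1 volume := by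
  obtain ⟨δ, C, hδ, hC, h⟩ := hf.exists_separation hQ hd b
  refine ⟨δ, C, hδ, hC, fun n z hz => ?_⟩
  set v := f (extremePt b) QX
  refine le_trans (ENNReal.ofReal_le_ofReal ?_)
    (ofReal_setIntegral_le_eLpNorm_one _ (Ioc (v - δ) v))
  rw [setIntegral_leakageCDF_sub hQ.1 hW n (by linarith)]
  simp only [sub_sub_cancel]
  -- Realisations of level at least `v` reach the top of the ramp; the others contribute
  -- nonnegatively and are dropped.
  have h1 : ∑ y : Fin n → Y, δ * (∑ x, if v ≤ f (extremePt x) QX then jointProb QX W n x y else 0)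
      ≤ ∑ x, QX x * min δ (max 0 (f (extremePt x) QX - (v - δ))) := by
    rw [← Finset.mul_sum, Finset.sum_comm, Finset.mul_sum]
    refine Finset.sum_le_sum fun x _ => ?_
    split_ifs with hx
    · rw [sum_jointProb hW, mul_comm]
      exact mul_le_mul_of_nonneg_left (le_min le_rfl (le_max_of_le_right (by linarith)))
        (hQ.1.1 x)
    · simp only [Finset.sum_const_zero, mul_zero]
      exact mul_nonneg (hQ.1.1 x) (le_min hδ.le (le_max_left _ _))
  have h2 : ∀ y : Fin n → Y,
      δ * min (jointProb QX W n b y) (jointProb QX W n z y) ≤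
        δ * (∑ x, if v ≤ f (extremePt x) QX then jointProb QX W n x y else 0)
        - outputProb QX W n y * min δ (max 0 (f (posterior QX W n y) QX - (v - δ)))
        + C * ∑ u, if v < f (extremePt u) QX then
            ∑ w ∈ Finset.univ.erase u, min (jointProb QX W n u y) (jointProb QX W n w y)
            else 0 := by
    intro y
    by_cases hy : outputProb QX W n y = 0
    · simp [← outputProb_mul_posterior hQ.1 hW, hy]
    · have h3 := mul_le_mul_of_nonneg_left
        (h _ (posterior_mem_stdSimplex hQ.1 hW hy) z hz) (outputProb_nonneg hQ.1 hW n y)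
      simp only [← outputProb_mul_posterior hQ.1 hW n _ y,
        ← mul_min_of_nonneg _ _ (outputProb_nonneg hQ.1 hW n y), ← Finset.mul_sum, ← mul_ite_zero]
      convert! h3 using 1
      · ring
      · rw [show f (posterior QX W n y) QX - (v - δ) = f (posterior QX W n y) QX - v + δ by ring]
        ring
  have h3 := Finset.sum_le_sum fun y (_ : y ∈ (Finset.univ : Finset (Fin n → Y))) => h2 y
  rw [Finset.sum_add_distrib, Finset.sum_sub_distrib, ← Finset.mul_sum] at h3
  have h4 : ∑ y : Fin n → Y, C * (∑ u, if v < f (extremePt u) QX then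
            ∑ w ∈ Finset.univ.erase u, min (jointProb QX W n u y) (jointProb QX W n w y)
            else 0) = C * ∑ u, if v < f (extremePt u) QX then
          ∑ w ∈ Finset.univ.erase u, pairError QX W n u w else 0 := by
    rw [← Finset.mul_sum, Finset.sum_comm]
    congr 1
    refine Finset.sum_congr rfl fun u _ => ?_
    split_ifs
    · rw [Finset.sum_comm]
      rfl
    · simp
  rw [h4] at h3
  simp only [pairError] at h3 ⊢
  linarith

end Distance

/-! ### The base-2 logarithm -/

section Log2

theorem log2_mono : Monotone log2 := fun _ _ h =>
  EReal.monotone_div_right_of_nonneg (EReal.coe_nonneg.2 (Real.log_nonneg one_le_two))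
    (ENNReal.log_monotone h)

theorem log2_zero : log2 0 = ⊥ := by
  rw [log2, ENNReal.log_zero]
  exact EReal.bot_div_of_pos_ne_top (EReal.coe_pos.2 (Real.log_pos one_lt_two))
    (EReal.coe_ne_top _)

theorem log2_ofReal {t : ℝ} (ht : 0 < t) :
    log2 (ENNReal.ofReal t) = ((Real.log t / Real.log 2 : ℝ) : EReal) := by
  rw [log2, ENNReal.log_ofReal_of_pos ht, EReal.coe_div]

end Log2

/-! ### Chernoff coefficients and testing of product measures -/

section Chernoff

variable {Y : Type*} {P Q : Y → ℝ}

/-- The weight `P ^ r * Q ^ (1 - r)`, restricted to the common support of `P` and `Q`. -/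
noncomputable def tilt (P Q : Y → ℝ) (r : ℝ) (y : Y) : ℝ :=
  if P y = 0 ∨ Q y = 0 then 0 else P y ^ r * Q y ^ (1 - r)

theorem tilt_nonneg (hP : ∀ y, 0 ≤ P y) (hQ : ∀ y, 0 ≤ Q y) (r : ℝ) (y : Y) :
    0 ≤ tilt P Q r y := by
  unfold tilt
  split_ifs
  · exact le_rfl
  · exact mul_nonneg (Real.rpow_nonneg (hP y) _) (Real.rpow_nonneg (hQ y) _)

theorem tilt_le (hP : ∀ y, 0 ≤ P y) (hQ : ∀ y, 0 ≤ Q y) (r : ℝ) (y : Y) :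
    tilt P Q r y ≤ P y ^ r * Q y ^ (1 - r) := by
  unfold tilt
  split_ifs
  · exact mul_nonneg (Real.rpow_nonneg (hP y) _) (Real.rpow_nonneg (hQ y) _)
  · exact le_rfl

theorem tilt_eq_of_mem_Ioo {r : ℝ} (hr : r ∈ Ioo (0 : ℝ) 1) (y : Y) :
    tilt P Q r y = P y ^ r * Q y ^ (1 - r) := by
  unfold tilt
  split_ifs with h
  · rcases h with h | h
    · rw [h, Real.zero_rpow hr.1.ne', zero_mul]
    · rw [h, Real.zero_rpow (by linarith [hr.2]), mul_zero]
  · rfl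

theorem hasDerivAt_tilt (hP : ∀ y, 0 ≤ P y) (hQ : ∀ y, 0 ≤ Q y) (r : ℝ) (y : Y) :
    HasDerivAt (fun r => tilt P Q r y)
      (tilt P Q r y * (Real.log (P y) - Real.log (Q y))) r := by
  unfold tilt
  split_ifs with h
  · simpa using hasDerivAt_const r (0 : ℝ)
  · push Not at h
    have h1 := (hasDerivAt_id' r).const_rpow (lt_of_le_of_ne (hP y) h.1.symm)
    have h2 := ((hasDerivAt_id' r).const_sub 1).const_rpow (lt_of_le_of_ne (hQ y) h.2.symm)
    convert! h1.mul h2 using 1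
    ring

theorem tilt_mul_exp_le_left (hP : ∀ y, 0 ≤ P y) (hQ : ∀ y, 0 ≤ Q y) (r : ℝ) (y : Y) :
    tilt P Q r y * Real.exp ((1 - r) * (Real.log (P y) - Real.log (Q y))) ≤ P y := by
  unfold tilt
  split_ifs with h
  · simpa using hP y
  · push Not at h
    have hp := lt_of_le_of_ne (hP y) h.1.symm
    have hq := lt_of_le_of_ne (hQ y) h.2.symm
    rw [Real.rpow_def_of_pos hp, Real.rpow_def_of_pos hq, ← Real.exp_add, ← Real.exp_add]
    refine le_of_eq ?_
    conv_rhs => rw [← Real.exp_log hp]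
    congr 1
    ring

theorem tilt_mul_exp_le_right (hP : ∀ y, 0 ≤ P y) (hQ : ∀ y, 0 ≤ Q y) (r : ℝ) (y : Y) :
    tilt P Q r y * Real.exp (-(r * (Real.log (P y) - Real.log (Q y)))) ≤ Q y := by
  unfold tilt
  split_ifs with h
  · simpa using hQ y
  · push Not at h
    have hp := lt_of_le_of_ne (hP y) h.1.symm
    have hq := lt_of_le_of_ne (hQ y) h.2.symm
    rw [Real.rpow_def_of_pos hp, Real.rpow_def_of_pos hq, ← Real.exp_add, ← Real.exp_add]
    refine le_of_eq ?_
    conv_rhs => rw [← Real.exp_log hq]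
    congr 1
    ring

/-- A minimum is at most any weighted geometric mean; off the common support the minimum is zero. -/
theorem min_prod_le_prod_tilt (hP : ∀ y, 0 ≤ P y) (hQ : ∀ y, 0 ≤ Q y) {r : ℝ}
    (hr : r ∈ Icc (0 : ℝ) 1) {n : ℕ} (y : Fin n → Y) :
    min (∏ i, P (y i)) (∏ i, Q (y i)) ≤ ∏ i, tilt P Q r (y i) := by
  by_cases h : ∃ i, P (y i) = 0 ∨ Q (y i) = 0
  · refine le_trans ?_ (Finset.prod_nonneg fun i _ => tilt_nonneg hP hQ r (y i))
    obtain ⟨i, hi | hi⟩ := h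
    · exact (min_le_left _ _).trans (Finset.prod_eq_zero (Finset.mem_univ i) hi).le
    · exact (min_le_right _ _).trans (Finset.prod_eq_zero (Finset.mem_univ i) hi).le
  · push Not at h
    have h1 : ∏ i, tilt P Q r (y i) = (∏ i, P (y i)) ^ r * (∏ i, Q (y i)) ^ (1 - r) := by
      rw [← Real.finsetProd_rpow _ _ fun i _ => hP _, ← Real.finsetProd_rpow _ _ fun i _ => hQ _,
        ← Finset.prod_mul_distrib]
      refine Finset.prod_congr rfl fun i _ => ?_
      rw [tilt, if_neg (by simpa using h i)]
    have hpos : 0 < min (∏ i, P (y i)) (∏ i, Q (y i)) := lt_min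
      (Finset.prod_pos fun i _ => lt_of_le_of_ne (hP _) (h i).1.symm)
      (Finset.prod_pos fun i _ => lt_of_le_of_ne (hQ _) (h i).2.symm)
    rw [h1]
    set m := min (∏ i, P (y i)) (∏ i, Q (y i))
    calc m = m ^ r * m ^ (1 - r) := by rw [← Real.rpow_add hpos]; simp
      _ ≤ _ := mul_le_mul (Real.rpow_le_rpow hpos.le (min_le_left _ _) hr.1)
        (Real.rpow_le_rpow hpos.le (min_le_right _ _) (sub_nonneg.2 hr.2))
        (Real.rpow_nonneg hpos.le _)
        (Real.rpow_nonneg (hpos.le.trans (min_le_left _ _)) _)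

variable [Fintype Y]

/-- `∑ P ^ r * Q ^ (1 - r)` over the common support of `P` and `Q`. -/
noncomputable def chernoffSum (P Q : Y → ℝ) (r : ℝ) : ℝ := ∑ y, tilt P Q r y

/-- The Chernoff coefficient, the minimum of `∑ P ^ r * Q ^ (1 - r)` over `r ∈ [0, 1]`. -/
noncomputable def chernoffCoeff (P Q : Y → ℝ) : ℝ := sInf (chernoffSum P Q '' Icc 0 1)

theorem hasDerivAt_chernoffSum (hP : ∀ y, 0 ≤ P y) (hQ : ∀ y, 0 ≤ Q y) (r : ℝ) :
    HasDerivAt (chernoffSum P Q)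
      (∑ y, tilt P Q r y * (Real.log (P y) - Real.log (Q y))) r := by
  unfold chernoffSum
  exact HasDerivAt.fun_sum fun y _ => hasDerivAt_tilt hP hQ r y

theorem chernoffSum_nonneg (hP : ∀ y, 0 ≤ P y) (hQ : ∀ y, 0 ≤ Q y) (r : ℝ) :
    0 ≤ chernoffSum P Q r := Finset.sum_nonneg fun y _ => tilt_nonneg hP hQ r y

theorem continuous_chernoffSum (hP : ∀ y, 0 ≤ P y) (hQ : ∀ y, 0 ≤ Q y) :
    Continuous (chernoffSum P Q) :=
  continuous_iff_continuousAt.2 fun r => (hasDerivAt_chernoffSum hP hQ r).continuousAt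

theorem exists_chernoffSum_eq_chernoffCoeff (hP : ∀ y, 0 ≤ P y) (hQ : ∀ y, 0 ≤ Q y) :
    ∃ r ∈ Icc (0 : ℝ) 1, chernoffSum P Q r = chernoffCoeff P Q := by
  obtain ⟨r, hr, h⟩ := isCompact_Icc.exists_sInf_image_eq (nonempty_Icc.2 zero_le_one)
    (continuous_chernoffSum hP hQ).continuousOn
  exact ⟨r, hr, h.symm⟩

theorem chernoffCoeff_le (hP : ∀ y, 0 ≤ P y) (hQ : ∀ y, 0 ≤ Q y) {r : ℝ}
    (hr : r ∈ Icc (0 : ℝ) 1) : chernoffCoeff P Q ≤ chernoffSum P Q r :=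
  csInf_le ⟨0, by rintro _ ⟨s, -, rfl⟩; exact chernoffSum_nonneg hP hQ s⟩ ⟨r, hr, rfl⟩

theorem chernoffCoeff_nonneg (hP : ∀ y, 0 ≤ P y) (hQ : ∀ y, 0 ≤ Q y) :
    0 ≤ chernoffCoeff P Q := by
  obtain ⟨r, -, h⟩ := exists_chernoffSum_eq_chernoffCoeff hP hQ
  exact h ▸ chernoffSum_nonneg hP hQ r

/-- The plain sum can exceed the restricted one only at the endpoints, and by continuity the minimum
of the latter is approached from the open interval. -/
theorem iInf_log2_eq (hP : ∀ y, 0 ≤ P y) (hQ : ∀ y, 0 ≤ Q y) :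
    ⨅ r ∈ Icc (0 : ℝ) 1, log2 (ENNReal.ofReal (∑ y, P y ^ r * Q y ^ (1 - r)))
      = log2 (ENNReal.ofReal (chernoffCoeff P Q)) := by
  refine le_antisymm ?_ (le_iInf₂ fun r hr => log2_mono (ENNReal.ofReal_le_ofReal
    ((chernoffCoeff_le hP hQ hr).trans (Finset.sum_le_sum fun y _ => tilt_le hP hQ r y))))
  have hle : ∀ r ∈ Ioo (0 : ℝ) 1,
      ⨅ r ∈ Icc (0 : ℝ) 1, log2 (ENNReal.ofReal (∑ y, P y ^ r * Q y ^ (1 - r)))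
        ≤ log2 (ENNReal.ofReal (chernoffSum P Q r)) := by
    intro r hr
    refine (iInf₂_le r (Ioo_subset_Icc_self hr)).trans_eq ?_
    simp only [chernoffSum, tilt_eq_of_mem_Ioo hr]
  obtain ⟨r, hr, h⟩ := exists_chernoffSum_eq_chernoffCoeff hP hQ
  have : (𝓝[Ioo 0 1] r).NeBot := by
    rw [← mem_closure_iff_nhdsWithin_neBot, closure_Ioo zero_ne_one]
    exact hr
  rcases (chernoffCoeff_nonneg hP hQ).eq_or_lt with h0 | h0
  -- A zero of the sum forces disjoint supports, so it vanishes identically and `r = 1 / 2` serves.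
  · have hz : ∀ s, chernoffSum P Q s = 0 := by
      intro s
      rw [← h0, chernoffSum,
        Finset.sum_eq_zero_iff_of_nonneg fun y _ => tilt_nonneg hP hQ r y] at h
      refine Finset.sum_eq_zero fun y hy => ?_
      have := h y hy
      unfold tilt at this ⊢
      split_ifs at this ⊢ with hs
      · rfl
      · push Not at hs
        have hp := lt_of_le_of_ne (hP y) hs.1.symm
        have hq := lt_of_le_of_ne (hQ y) hs.2.symm
        exact absurd this (by positivity)
    have := hle (1 / 2) (by norm_num)
    rw [← h0]
    rwa [hz] at this
  · have ht : Tendsto (chernoffSum P Q) (𝓝[Ioo 0 1] r) (𝓝 (chernoffCoeff P Q)) :=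
      h ▸ ((continuous_chernoffSum hP hQ).tendsto r).mono_left nhdsWithin_le_nhds
    have ht2 : Tendsto (fun s => ((Real.log (chernoffSum P Q s) / Real.log 2 : ℝ) : EReal))
        (𝓝[Ioo 0 1] r) (𝓝 ((Real.log (chernoffCoeff P Q) / Real.log 2 : ℝ) : EReal)) :=
      (continuous_coe_real_ereal.tendsto _).comp ((ht.log h0.ne').div_const _)
    rw [log2_ofReal h0]
    refine ge_of_tendsto ht2 ?_
    filter_upwards [self_mem_nhdsWithin, ht.eventually (lt_mem_nhds h0)] with s hs hs0
    rw [← log2_ofReal hs0]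
    exact hle s hs

theorem chernoffInfo_eq (hP : ∀ y, 0 ≤ P y) (hQ : ∀ y, 0 ≤ Q y) :
    chernoffInfo P Q = -log2 (ENNReal.ofReal (chernoffCoeff P Q)) := by
  rw [chernoffInfo, iInf_log2_eq hP hQ]

theorem sum_min_prod_le (hP : ∀ y, 0 ≤ P y) (hQ : ∀ y, 0 ≤ Q y) (n : ℕ) :
    ∑ y : Fin n → Y, min (∏ i, P (y i)) (∏ i, Q (y i)) ≤ chernoffCoeff P Q ^ n := by
  obtain ⟨r, hr, h⟩ := exists_chernoffSum_eq_chernoffCoeff hP hQ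
  rw [← h, chernoffSum, Fintype.sum_pow]
  exact Finset.sum_le_sum fun y _ => min_prod_le_prod_tilt hP hQ hr y

/-- An exponential form of the weak law of large numbers on a finite set. -/
theorem exists_sum_deviation_le {T g : Y → ℝ} (hT : T ∈ stdSimplex ℝ Y)
    (hg : ∑ y, T y * g y ≤ 0) {δ : ℝ} (hδ : 0 < δ) :
    ∃ θ : ℝ, 0 ≤ θ ∧ θ < 1 ∧ ∀ n : ℕ,
      ∑ y : Fin n → Y, (if n * δ < ∑ i, g (y i) then ∏ i, T (y i) else 0) ≤ θ ^ n := by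
  -- The exponential Markov inequality: `ψ 0 = 1` and `ψ` has negative derivative at 0, so some `s >
  -- 0` gives the rate `θ = ψ s < 1`.
  let ψ : ℝ → ℝ := fun s => ∑ y, T y * Real.exp (s * (g y - δ))
  have hψ0 : ψ 0 = 1 := by simp [ψ, hT.2]
  have hψ' : HasDerivAt ψ (∑ y, T y * (g y - δ)) 0 := by
    refine HasDerivAt.fun_sum fun y _ => ?_
    have := (((hasDerivAt_id' (0 : ℝ)).mul_const (g y - δ)).exp).const_mul (T y)
    simpa using this
  have hneg : ∑ y, T y * (g y - δ) < 0 := by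
    simp only [mul_sub, Finset.sum_sub_distrib, ← Finset.sum_mul, hT.2]
    linarith
  obtain ⟨s, hs0, hs1⟩ : ∃ s > 0, ψ s < 1 := by
    have h := (hasDerivAt_iff_tendsto_slope_zero.1 hψ').eventually (gt_mem_nhds hneg)
    have h' : ∀ᶠ t in 𝓝[>] (0 : ℝ), t⁻¹ • (ψ (0 + t) - ψ 0) < 0 :=
      h.filter_mono (nhdsWithin_mono _ fun x hx => ne_of_gt hx)
    obtain ⟨s, hs, hs0⟩ := (h'.and self_mem_nhdsWithin).exists
    have hs0 : 0 < s := hs0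
    refine ⟨s, hs0, ?_⟩
    rw [smul_eq_mul, zero_add, hψ0] at hs
    by_contra! hc
    linarith [mul_nonneg (inv_pos.2 hs0).le (sub_nonneg.2 hc)]
  refine ⟨ψ s, Finset.sum_nonneg fun y _ => mul_nonneg (hT.1 y) (Real.exp_pos _).le, hs1,
    fun n => ?_⟩
  simp only [ψ]
  rw [Fintype.sum_pow]
  refine Finset.sum_le_sum fun y _ => ?_
  have hTp : 0 ≤ ∏ i, T (y i) := Finset.prod_nonneg fun i _ => hT.1 _
  rw [Finset.prod_mul_distrib, ← Real.exp_sum]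
  split_ifs with h
  · refine le_mul_of_one_le_right hTp (Real.one_le_exp ?_)
    rw [← Finset.mul_sum, Finset.sum_sub_distrib]
    simp only [Finset.sum_const, Finset.card_univ, Fintype.card_fin, nsmul_eq_mul]
    exact mul_nonneg hs0.le (by linarith)
  · exact mul_nonneg hTp (Real.exp_pos _).le

/-- The converse part of Chernoff's theorem. -/
theorem eventually_le_sum_min_prod (hP : ∀ y, 0 ≤ P y) (hQ : ∀ y, 0 ≤ Q y)
    (hκ : 0 < chernoffCoeff P Q) {δ : ℝ} (hδ : 0 < δ) :
    ∀ᶠ n : ℕ in atTop, 1 / 2 * (chernoffCoeff P Q * Real.exp (-δ)) ^ n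
      ≤ ∑ y : Fin n → Y, min (∏ i, P (y i)) (∏ i, Q (y i)) := by
  obtain ⟨r, hr, h⟩ := exists_chernoffSum_eq_chernoffCoeff hP hQ
  set κ := chernoffCoeff P Q with hκdef
  let L : Y → ℝ := fun y => Real.log (P y) - Real.log (Q y)
  -- Change of measure to the tilted law at the minimising `r`, under which both hypotheses are
  -- typical up to the factor `κ ^ n`.
  let T : Y → ℝ := fun y => tilt P Q r y / κ
  have hT : T ∈ stdSimplex ℝ Y := by
    refine ⟨fun y => div_nonneg (tilt_nonneg hP hQ r y) hκ.le, ?_⟩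
    simp only [T, ← Finset.sum_div]
    rw [← chernoffSum, h, div_self hκ.ne']
  -- First-order optimality in a form valid for endpoint minimisers too; `s = 1` and `s = 0` give
  -- the two sign conditions needed for the deviation bounds.
  have hderiv : ∀ s ∈ Icc (0 : ℝ) 1, 0 ≤ (s - r) * ∑ y, T y * L y := by
    intro s hs
    have hmin : IsLocalMinOn (chernoffSum P Q) (Icc 0 1) r := by
      refine IsMinOn.localize fun t ht => ?_
      change chernoffSum P Q r ≤ chernoffSum P Q t
      rw [h]
      exact chernoffCoeff_le hP hQ ht
    have h1 := hmin.hasFDerivWithinAt_nonneg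
      (hasDerivAt_chernoffSum hP hQ r).hasFDerivAt.hasFDerivWithinAt
      (sub_mem_posTangentConeAt_of_segment_subset ((convex_Icc 0 1).segment_subset hr hs))
    have h2 : ∑ y, T y * L y =
        (∑ y, tilt P Q r y * (Real.log (P y) - Real.log (Q y))) / κ := by
      rw [Finset.sum_div]
      exact Finset.sum_congr rfl fun y _ => by simp only [T, L]; ring
    rw [h2, ← mul_div_assoc]
    refine div_nonneg ?_ hκ.le
    simpa using h1
  obtain ⟨θ₁, h10, h11, h1⟩ := exists_sum_deviation_le (g := fun y => -((1 - r) * L y)) hT (by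
    have := hderiv 1 (by simp)
    simp only [mul_neg, Finset.sum_neg_distrib, mul_left_comm _ (1 - r), ← Finset.mul_sum]
    linarith) hδ
  obtain ⟨θ₂, h20, h21, h2⟩ := exists_sum_deviation_le (g := fun y => r * L y) hT (by
    have := hderiv 0 (by simp)
    simp only [mul_left_comm _ r, ← Finset.mul_sum]
    linarith) hδ
  have e1 := (tendsto_pow_atTop_nhds_zero_of_lt_one h10 h11).eventually
    (gt_mem_nhds (show (0 : ℝ) < 1 / 4 by norm_num))
  have e2 := (tendsto_pow_atTop_nhds_zero_of_lt_one h20 h21).eventually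
    (gt_mem_nhds (show (0 : ℝ) < 1 / 4 by norm_num))
  filter_upwards [e1, e2] with n hn1 hn2
  -- On either deviation event the left factor is nonpositive; off both, the log-likelihood terms
  -- cost at most `n * δ`. Each event has tilted mass below 1/4, which leaves the factor 1/2.
  have hpt : ∀ y : Fin n → Y, (κ * Real.exp (-δ)) ^ n * (∏ i, T (y i)
      - (if n * δ < ∑ i, -((1 - r) * L (y i)) then ∏ i, T (y i) else 0)
      - (if n * δ < ∑ i, r * L (y i) then ∏ i, T (y i) else 0))
      ≤ min (∏ i, P (y i)) (∏ i, Q (y i)) := by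
    intro y
    have hTp : 0 ≤ ∏ i, T (y i) := Finset.prod_nonneg fun i _ => hT.1 _
    have hκn : 0 ≤ (κ * Real.exp (-δ)) ^ n := by positivity
    have hm : 0 ≤ min (∏ i, P (y i)) (∏ i, Q (y i)) :=
      le_min (Finset.prod_nonneg fun i _ => hP _) (Finset.prod_nonneg fun i _ => hQ _)
    have hprod : (κ * Real.exp (-δ)) ^ n * ∏ i, T (y i)
        = (∏ i, tilt P Q r (y i)) * Real.exp (-(n * δ)) := by
      simp only [T, Finset.prod_div_distrib, Finset.prod_const, Finset.card_univ,
        Fintype.card_fin, mul_pow, ← Real.exp_nat_mul]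
      field_simp
    have htp : 0 ≤ ∏ i, tilt P Q r (y i) := Finset.prod_nonneg fun i _ => tilt_nonneg hP hQ r _
    split_ifs with hb1 hb2 hb2
    · exact le_trans (mul_nonpos_of_nonneg_of_nonpos hκn (by linarith)) hm
    · exact le_trans (mul_nonpos_of_nonneg_of_nonpos hκn (by linarith)) hm
    · exact le_trans (mul_nonpos_of_nonneg_of_nonpos hκn (by linarith)) hm
    · rw [sub_zero, sub_zero, hprod]
      rw [not_lt, Finset.sum_neg_distrib] at hb1
      rw [not_lt] at hb2
      refine le_min ?_ ?_
      · calc _ ≤ (∏ i, tilt P Q r (y i)) * Real.exp (∑ i, (1 - r) * L (y i)) :=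
              mul_le_mul_of_nonneg_left (Real.exp_le_exp.2 (by linarith)) htp
          _ = ∏ i, tilt P Q r (y i) * Real.exp ((1 - r) * L (y i)) := by
              rw [Finset.prod_mul_distrib, Real.exp_sum]
          _ ≤ _ := Finset.prod_le_prod
              (fun i _ => mul_nonneg (tilt_nonneg hP hQ r _) (Real.exp_pos _).le)
              fun i _ => tilt_mul_exp_le_left hP hQ r _
      · calc _ ≤ (∏ i, tilt P Q r (y i)) * Real.exp (∑ i, -(r * L (y i))) :=
              mul_le_mul_of_nonneg_left (Real.exp_le_exp.2 (by
                rw [Finset.sum_neg_distrib]; linarith)) htp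
          _ = ∏ i, tilt P Q r (y i) * Real.exp (-(r * L (y i))) := by
              rw [Finset.prod_mul_distrib, Real.exp_sum]
          _ ≤ _ := Finset.prod_le_prod
              (fun i _ => mul_nonneg (tilt_nonneg hP hQ r _) (Real.exp_pos _).le)
              fun i _ => tilt_mul_exp_le_right hP hQ r _
  refine le_trans ?_ (Finset.sum_le_sum fun y _ => hpt y)
  rw [← Finset.mul_sum, Finset.sum_sub_distrib, Finset.sum_sub_distrib, ← Fintype.sum_pow, hT.2,
    one_pow, mul_comm]
  refine mul_le_mul_of_nonneg_left ?_ (by positivity)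
  linarith [h1 n, h2 n]

end Chernoff

/-! ### Exponential bounds on pair errors -/

section PairError

variable {X Y : Type*} [Fintype X] [Fintype Y] {QX : X → ℝ} {W : X → Y → ℝ}

theorem pairError_le (hQ : QX ∈ stdSimplex ℝ X) (hW : ∀ x, W x ∈ stdSimplex ℝ Y) (n : ℕ)
    (x z : X) : pairError QX W n x z ≤ chernoffCoeff (W x) (W z) ^ n := by
  classical
  refine le_trans (Finset.sum_le_sum fun y _ => ?_) (sum_min_prod_le (hW x).1 (hW z).1 n)
  exact min_le_min
    (mul_le_of_le_one_left (Finset.prod_nonneg fun i _ => (hW x).1 _)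
      (stdSimplex_apply_le_one hQ x))
    (mul_le_of_le_one_left (Finset.prod_nonneg fun i _ => (hW z).1 _)
      (stdSimplex_apply_le_one hQ z))

theorem eventually_le_pairError (hQ : QX ∈ stdSimplex ℝ X) (hW : ∀ x, W x ∈ stdSimplex ℝ Y)
    {x z : X} (hκ : 0 < chernoffCoeff (W x) (W z)) {δ : ℝ} (hδ : 0 < δ) :
    ∀ᶠ n : ℕ in atTop, min (QX x) (QX z) / 2 *
      (chernoffCoeff (W x) (W z) * Real.exp (-δ)) ^ n ≤ pairError QX W n x z := by
  filter_upwards [eventually_le_sum_min_prod (hW x).1 (hW z).1 hκ hδ] with n hn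
  have hm : 0 ≤ min (QX x) (QX z) := le_min (hQ.1 x) (hQ.1 z)
  calc _ = min (QX x) (QX z) * (1 / 2 * (chernoffCoeff (W x) (W z) * Real.exp (-δ)) ^ n) := by
        ring
    _ ≤ min (QX x) (QX z) * ∑ y : Fin n → Y, min (∏ i, W x (y i)) (∏ i, W z (y i)) :=
        mul_le_mul_of_nonneg_left hn hm
    _ ≤ pairError QX W n x z := by
        rw [Finset.mul_sum]
        refine Finset.sum_le_sum fun y _ => ?_
        rw [mul_min_of_nonneg _ _ hm]
        exact min_le_min
          (mul_le_mul_of_nonneg_right (min_le_left _ _)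
            (Finset.prod_nonneg fun i _ => (hW x).1 _))
          (mul_le_mul_of_nonneg_right (min_le_right _ _)
            (Finset.prod_nonneg fun i _ => (hW z).1 _))

end PairError

/-! ### From exponential bounds to normalised logarithms -/

section Exponent

theorem log2_ofReal_mul_pow {A κ : ℝ} (hA : 0 < A) (hκ : 0 < κ) {n : ℕ} (hn : n ≠ 0) :
    ((1 / (n : ℝ) : ℝ) : EReal) * log2 (ENNReal.ofReal (A * κ ^ n))
      = ((Real.log A / Real.log 2 * (n : ℝ)⁻¹ + Real.log κ / Real.log 2 : ℝ) : EReal) := by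
  rw [log2_ofReal (by positivity), ← EReal.coe_mul, Real.log_mul hA.ne' (by positivity),
    Real.log_pow]
  congr 1
  have : (n : ℝ) ≠ 0 := Nat.cast_ne_zero.2 hn
  field_simp

theorem tendsto_log2_ofReal_mul_pow {A κ : ℝ} (hA : 0 < A) (hκ : 0 < κ) :
    Tendsto (fun n : ℕ => ((1 / (n : ℝ) : ℝ) : EReal) * log2 (ENNReal.ofReal (A * κ ^ n)))
      atTop (𝓝 ((Real.log κ / Real.log 2 : ℝ) : EReal)) := by
  have h : Tendsto (fun n : ℕ => Real.log A / Real.log 2 * (n : ℝ)⁻¹ + Real.log κ / Real.log 2)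
      atTop (𝓝 (Real.log κ / Real.log 2)) := by
    simpa using (tendsto_inv_atTop_nhds_zero_nat.const_mul
      (Real.log A / Real.log 2)).add_const (Real.log κ / Real.log 2)
  refine ((continuous_coe_real_ereal.tendsto _).comp h).congr' ?_
  filter_upwards [eventually_ne_atTop 0] with n hn
  exact (log2_ofReal_mul_pow hA hκ hn).symm

theorem mul_log2_mono (n : ℕ) {a b : ℝ≥0∞} (h : a ≤ b) :
    ((1 / (n : ℝ) : ℝ) : EReal) * log2 a ≤ ((1 / (n : ℝ) : ℝ) : EReal) * log2 b :=
  mul_le_mul_of_nonneg_left (log2_mono h) (EReal.coe_nonneg.2 (by positivity))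

theorem limsup_mul_log2_le {d : ℕ → ℝ≥0∞} {A κ : ℝ} (hκ : 0 ≤ κ)
    (h : ∀ n, d n ≤ ENNReal.ofReal (A * κ ^ n)) :
    limsup (fun n : ℕ => ((1 / (n : ℝ) : ℝ) : EReal) * log2 (d n)) atTop
      ≤ log2 (ENNReal.ofReal κ) := by
  rcases hκ.eq_or_lt with rfl | hκ
  · refine limsup_le_of_le (by isBoundedDefault) ?_
    -- The index 0 is excluded because `0 ^ 0 = 1`.
    filter_upwards [eventually_ne_atTop 0] with n hn
    have h0 : d n = 0 := by simpa [hn] using h n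
    have hn' : (0 : ℝ) < 1 / (n : ℝ) := by positivity
    rw [h0, log2_zero, EReal.coe_mul_bot_of_pos hn']
    exact bot_le
  -- Raising the constant to at least 1 keeps its logarithm finite.
  · have h' : ∀ n, d n ≤ ENNReal.ofReal (max A 1 * κ ^ n) := fun n => (h n).trans
      (ENNReal.ofReal_le_ofReal (mul_le_mul_of_nonneg_right (le_max_left _ _) (by positivity)))
    rw [log2_ofReal hκ, ← (tendsto_log2_ofReal_mul_pow
      (lt_max_of_lt_right one_pos : 0 < max A 1) hκ).limsup_eq]
    exact limsup_le_limsup (Eventually.of_forall fun n => mul_log2_mono n (h' n))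

theorem le_liminf_mul_log2 {d : ℕ → ℝ≥0∞} {κ : ℝ} (hκ : 0 < κ)
    (h : ∀ δ > 0, ∃ c > 0, ∀ᶠ n in atTop,
      ENNReal.ofReal (c * (κ * Real.exp (-δ)) ^ n) ≤ d n) :
    log2 (ENNReal.ofReal κ)
      ≤ liminf (fun n : ℕ => ((1 / (n : ℝ) : ℝ) : EReal) * log2 (d n)) atTop := by
  rw [log2_ofReal hκ]
  have h1 : ∀ δ > 0, (((Real.log κ - δ) / Real.log 2 : ℝ) : EReal)
      ≤ liminf (fun n : ℕ => ((1 / (n : ℝ) : ℝ) : EReal) * log2 (d n)) atTop := by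
    intro δ hδ
    obtain ⟨c, hc, hev⟩ := h δ hδ
    have h2 := tendsto_log2_ofReal_mul_pow hc (show 0 < κ * Real.exp (-δ) by positivity)
    rw [Real.log_mul hκ.ne' (Real.exp_pos _).ne', Real.log_exp, ← sub_eq_add_neg] at h2
    rw [← h2.liminf_eq]
    exact liminf_le_liminf (hev.mono fun n hn => mul_log2_mono n hn)
  have h3 : Tendsto (fun δ : ℝ => (((Real.log κ - δ) / Real.log 2 : ℝ) : EReal)) (𝓝[>] 0)
      (𝓝 ((Real.log κ / Real.log 2 : ℝ) : EReal)) := by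
    have : Continuous fun δ : ℝ => (((Real.log κ - δ) / Real.log 2 : ℝ) : EReal) :=
      continuous_coe_real_ereal.comp (by fun_prop)
    have h4 := this.tendsto 0
    rw [sub_zero] at h4
    exact h4.mono_left nhdsWithin_le_nhds
  exact le_of_tendsto h3 (by filter_upwards [self_mem_nhdsWithin] with δ hδ using h1 δ hδ)

end Exponent

/-! ### Choice of the critical pair and conclusion -/

section Main

variable {X Y : Type*} [Fintype X] [DecidableEq X] [Fintype Y]

/-- On a one-point alphabet the prior is itself extreme, and zero leakage at the prior contradicts
positivity there. This ensures that a pair of distinct inputs exists. -/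
theorem IsPointwiseLeakage.nontrivial {f : (X → ℝ) → (X → ℝ) → ℝ} (hf : IsPointwiseLeakage f)
    {Q : X → ℝ} (hQ : Q ∈ fullSupport X) : Nontrivial X := by
  have hne : Nonempty X := by
    by_contra h
    rw [not_nonempty_iff] at h
    simpa using hQ.1.2
  obtain ⟨x⟩ := hne
  by_contra h
  rw [not_nontrivial_iff_subsingleton] at h
  have h1 : Q = extremePt x := by
    by_contra h2
    have h3 := stdSimplex_sum_erase hQ.1 x
    rw [Finset.sum_eq_zero fun z hz =>
      absurd (Subsingleton.elim z x) (Finset.ne_of_mem_erase hz)] at h3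
    linarith [stdSimplex_apply_lt_one hQ.1 h2]
  have h2 := hf.extreme_pos Q hQ x
  have h3 := hf.self_eq_zero Q hQ
  rw [← h1, h3] at h2
  exact lt_irrefl _ h2

theorem neg_minChernoff_eq {X Y : Type*} [Fintype Y] {W : X → Y → ℝ} (hW : ∀ x, W x ∈ stdSimplex ℝ Y) {b z : X}
    (hbz : b ≠ z)
    (hmax : ∀ x x', x ≠ x' → chernoffCoeff (W x) (W x') ≤ chernoffCoeff (W b) (W z)) :
    -minChernoff W = log2 (ENNReal.ofReal (chernoffCoeff (W b) (W z))) := by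
  rw [neg_eq_iff_eq_neg, minChernoff]
  simp only [fun x x' => chernoffInfo_eq (hW x).1 (hW x').1]
  refine le_antisymm ((iInf_le _ b).trans ((iInf_le _ z).trans (iInf_le _ hbz))) ?_
  exact le_iInf fun x => le_iInf fun x' => le_iInf fun h => EReal.neg_le_neg_iff.2
    (log2_mono (ENNReal.ofReal_le_ofReal (hmax x x' h)))

end Main

theorem theorem2 {X Y : Type*} [Fintype X] [DecidableEq X] [Fintype Y]
    (QX : X → ℝ) (hQX : QX ∈ fullSupport X)
    (W : X → Y → ℝ) (hW : ∀ x, W x ∈ stdSimplex ℝ Y) (hWinj : Function.Injective W)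
    (f : (X → ℝ) → (X → ℝ) → ℝ) (hf : IsPointwiseLeakage f) :
    limsup (fun n : ℕ => normalizedLogDist f QX W n) atTop ≤ -minChernoff W ∧
      (HasDerivativeProperty f QX →
        Tendsto (fun n : ℕ => normalizedLogDist f QX W n) atTop (𝓝 (-minChernoff W))) := by
  have hX := hf.nontrivial hQX
  let κ : X → X → ℝ := fun x z => chernoffCoeff (W x) (W z)
  have hκ0 : ∀ x z, 0 ≤ κ x z := fun x z => chernoffCoeff_nonneg (hW x).1 (hW z).1
  -- Ties for the largest coefficient are broken by the largest information of the first entry, so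
  -- every pair starting at a more informative realisation has a strictly smaller coefficient.
  obtain ⟨b, z, hbz, hmax, hstrict⟩ : ∃ b z, b ≠ z ∧ (∀ x x', x ≠ x' → κ x x' ≤ κ b z) ∧
      ∀ u w, u ≠ w → f (extremePt b) QX < f (extremePt u) QX → κ u w < κ b z := by
    have hne : (Finset.univ.offDiag : Finset (X × X)).Nonempty := by
      obtain ⟨x, y, hxy⟩ := exists_pair_ne X
      exact ⟨(x, y), by simpa using hxy⟩
    obtain ⟨p, hp, hpm⟩ := Finset.exists_max_image _ (fun p : X × X => κ p.1 p.2) hne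
    obtain ⟨q, hq, hqm⟩ := Finset.exists_max_image
      ((Finset.univ.offDiag : Finset (X × X)).filter fun q => κ q.1 q.2 = κ p.1 p.2)
      (fun q => f (extremePt q.1) QX) ⟨p, by simp_all⟩
    simp only [Finset.mem_filter, Finset.mem_offDiag, Finset.mem_univ, true_and] at hp hpm hq hqm
    refine ⟨q.1, q.2, hq.1, fun x x' h => hq.2 ▸ hpm (x, x') h, fun u w h hu => ?_⟩
    refine lt_of_le_of_ne (hq.2 ▸ hpm (u, w) h) fun he => ?_
    exact absurd (hqm (u, w) ⟨h, he.trans hq.2⟩) (not_le.2 hu)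
  rw [neg_minChernoff_eq hW hbz hmax]
  have hup : limsup (fun n : ℕ => normalizedLogDist f QX W n) atTop
      ≤ log2 (ENNReal.ofReal (κ b z)) := by
    obtain ⟨A, hA, h⟩ := hf.exists_eLpNorm_le hQX hW
    refine limsup_mul_log2_le (A := A * ∑ x : X, ∑ z ∈ Finset.univ.erase x, 1) (hκ0 b z)
      fun n => (h n).trans (ENNReal.ofReal_le_ofReal ?_)
    rw [mul_assoc, Finset.sum_mul]
    refine mul_le_mul_of_nonneg_left (Finset.sum_le_sum fun x _ => ?_) hA
    rw [Finset.sum_mul]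
    refine Finset.sum_le_sum fun w hw => ?_
    rw [one_mul]
    exact (pairError_le hQX.1 hW n x w).trans (pow_le_pow_left₀ (hκ0 x w)
      (hmax x w (Finset.ne_of_mem_erase hw).symm) n)
  refine ⟨hup, fun hd => ?_⟩
  -- If the largest coefficient is zero, the target is `⊥` and the upper bound alone gives the
  -- limit.
  rcases (hκ0 b z).eq_or_lt with h0 | h0
  · have hbot : log2 (ENNReal.ofReal (κ b z)) = ⊥ := by
      rw [← h0, ENNReal.ofReal_zero, log2_zero]
    rw [hbot] at hup
    change Tendsto _ _ (𝓝 (log2 (ENNReal.ofReal (κ b z))))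
    rw [hbot]
    exact tendsto_of_le_liminf_of_limsup_le bot_le hup
  refine tendsto_of_le_liminf_of_limsup_le (le_liminf_mul_log2 h0 fun δ hδ => ?_) hup
  obtain ⟨ε, C, hε, hC, hlow⟩ := hf.exists_le_eLpNorm hQX hW hd b
  have hm : 0 < min (QX b) (QX z) := lt_min (hQX.2 b) (hQX.2 z)
  -- The loss `η` in the Chernoff converse is made small enough that the reduced main rate still
  -- beats the rates of all correction terms.
  obtain ⟨η, ⟨hη0, hηδ⟩, hη⟩ : ∃ η ∈ Ioo 0 δ, ∀ u w, u ≠ w →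
      f (extremePt b) QX < f (extremePt u) QX → κ u w < κ b z * Real.exp (-η) := by
    have hc : Continuous fun η : ℝ => κ b z * Real.exp (-η) := by fun_prop
    have ht := hc.tendsto 0
    rw [neg_zero, Real.exp_zero, mul_one] at ht
    have hev : ∀ᶠ η in 𝓝[>] (0 : ℝ), ∀ u w, u ≠ w →
        f (extremePt b) QX < f (extremePt u) QX → κ u w < κ b z * Real.exp (-η) := by
      simp only [eventually_all]
      exact fun u w huw hu =>
        (ht.mono_left nhdsWithin_le_nhds).eventually (lt_mem_nhds (hstrict u w huw hu))
    obtain ⟨η, h1, h2⟩ := (hev.and (Ioo_mem_nhdsGT hδ)).exists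
    exact ⟨η, h2, h1⟩
  set t := κ b z * Real.exp (-η)
  have ht0 : 0 < t := mul_pos h0 (Real.exp_pos _)
  have hN : Tendsto (fun n : ℕ => C * ∑ u, if f (extremePt b) QX < f (extremePt u) QX then
      ∑ w ∈ Finset.univ.erase u, (κ u w / t) ^ n else 0) atTop (𝓝 (C * ∑ _u : X, 0)) := by
    refine (tendsto_finsetSum _ fun u _ => ?_).const_mul C
    split_ifs with hu
    · rw [← Finset.sum_const_zero (s := Finset.univ.erase u)]
      exact tendsto_finsetSum _ fun w hw => tendsto_pow_atTop_nhds_zero_of_lt_one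
        (div_nonneg (hκ0 u w) ht0.le)
        ((div_lt_one ht0).2 (hη u w (Finset.ne_of_mem_erase hw).symm hu))
    · exact tendsto_const_nhds
  rw [Finset.sum_const_zero, mul_zero] at hN
  -- The main term contributes twice this constant times `t ^ n`, and the correction takes away at
  -- most half of it.
  refine ⟨ε * min (QX b) (QX z) / 4, by positivity, ?_⟩
  filter_upwards [eventually_le_pairError hQX.1 hW h0 hη0, hN.eventually
    (gt_mem_nhds (show 0 < ε * min (QX b) (QX z) / 4 by positivity))] with n h1 h2
  refine le_trans (ENNReal.ofReal_le_ofReal ?_) (hlow n z hbz.symm)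
  have h3 : C * (∑ u, if f (extremePt b) QX < f (extremePt u) QX then
      ∑ w ∈ Finset.univ.erase u, pairError QX W n u w else 0)
      ≤ ε * min (QX b) (QX z) / 4 * t ^ n := by
    refine le_trans ?_ (mul_le_mul_of_nonneg_right h2.le (by positivity))
    rw [mul_assoc, Finset.sum_mul]
    refine mul_le_mul_of_nonneg_left (Finset.sum_le_sum fun u _ => ?_) hC
    split_ifs
    · rw [Finset.sum_mul]
      refine Finset.sum_le_sum fun w _ => ?_
      rw [← mul_pow, div_mul_cancel₀ _ ht0.ne']
      exact pairError_le hQX.1 hW n u w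
    · simp
  have h4 : (κ b z * Real.exp (-δ)) ^ n ≤ t ^ n :=
    pow_le_pow_left₀ (by positivity)
      (mul_le_mul_of_nonneg_left (Real.exp_le_exp.2 (by linarith)) h0.le) n
  have h5 := mul_le_mul_of_nonneg_left h4
    (show 0 ≤ ε * min (QX b) (QX z) / 4 by positivity)
  have h6 := mul_le_mul_of_nonneg_left h1 hε.le
  change ε * (min (QX b) (QX z) / 2 * t ^ n) ≤ _ at h6
  linarith
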